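/- \textbf{Theorem (canonical representation).} Let $w$ be a strictly positive analytic weight on the unit circle, i.e. $w>0$ on $|z|=1$ and $w$ is the restriction of a function holomorphic in a neighbourhood of $|z|=1$. Then there is exactly one sequence of polynomials $\varphi_n(z)=\kappa_nz^n+\dots$ of degree $n$, $\kappa_n>0$, with $\oint_{|z|=1}\varphi_n\overline{\varphi_m}\,w\,|dz|=\delta_{mn}$, where $|dz|$ is arc length. Put $\Phi_n=\varphi_n/\kappa_n$, $\varphi_n^*(z)=z^n\overline{\varphi_n(1/\bar z)}$, $\alpha_n=-\overline{\Phi_{n+1}(0)}$. Let $$D(w;z)=\exp\Big(\frac1{4\pi}\int_0^{2\pi}\log w(e^{i\theta})\,\frac{e^{i\theta}+z}{e^{i\theta}-z}\,d\theta\Big)\quad(|z|\ne1),\qquad \tau=\exp\Big(-\frac1{4\pi}\int_0^{2\pi}\log w(e^{i\theta})\,d\theta\Big),$$ let $D_i$, $D_e$ be $D$ in $|z|<1$ and in $|z|>1$ respectively, and let $$\rho=\inf\{0<s<1:\ D_e\text{ continues holomorphically to }|z|>s\}.$$ Continue $D_e$ holomorphically to $|z|>\rho$ and $1/D_i$ holomorphically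 to $|z|<1/\rho$ (so $D_i$ is continued meromorphically), and put $w=D_i/D_e$ and $\mathcal S=D_iD_e$ in $\rho<|z|<1/\rho$. Fix $r$ with $\rho<r<1$. For $n\ge 1$ and for functions $f$ with continuous exterior boundary values $f_-$ on the respective circle, let $$\mathcal M_n^{i}(f)(z)=-\frac1{2\pi i\,\tau^2}\oint_{|t|=r}f_-(t)\frac{\mathcal S(t)\,t^n}{t-z}\,dt,\qquad \mathcal M_n^{e}(f)(z)=\frac{\tau^2}{2\pi i}\oint_{|t|=1/r}f_-(t)\frac{dt}{\mathcal S(t)\,t^n\,(t-z)},$$ with both circles oriented counterclockwise. Set $f_n^{(0)}=g_n^{(0)}=1$ and, for $k\ge0$, $$f_n^{(2k+1)}=\mathcal M_n^i(f_n^{(2k)}),\quad f_n^{(2k+2)}=\mathcal M_n^e(f_n^{(2k+1)}),\quad g_n^{(2k+1)}=\mathcal M_n^e(g_n^{(2k)}),\quad g_n^{(2k+2)}=\mathcal M_n^i(g_n^{(2k+1)}).$$ Then for all sufficiently large $n$ the following holds. The series $$S_{11}(n;z)=\sum_{k\ge0}f_n^{(2k)}(z),\quad S_{21}(n;z)=\sum_{k\ge0}g_n^{(2k+1)}(z)\quad(|z|\ne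 1/r),$$ $$S_{12}(n;z)=\sum_{k\ge0}f_n^{(2k+1)}(z),\quad S_{22}(n;z)=\sum_{k\ge0}g_n^{(2k)}(z)\quad(|z|\ne r)$$ converge absolutely and uniformly on the indicated sets. For $|z|\notin\{r,1,1/r\}$ they are the entries of the matrix $S=YHKN^{-1}$, where $$Y(z)=\begin{pmatrix}\Phi_n(z)&\frac1{2\pi i}\oint_{|t|=1}\frac{\Phi_n(t)w(t)\,dt}{t^n(t-z)}\\[1mm]-2\pi\kappa_{n-1}\varphi_{n-1}^*(z)&-\frac{\kappa_{n-1}}{i}\oint_{|t|=1}\frac{\varphi_{n-1}^*(t)w(t)\,dt}{t^n(t-z)}\end{pmatrix};$$ $H=\mathrm{diag}(z^{-n},z^n)$ if $|z|>1$ and $H=I$ if $|z|<1$; $K=\begin{pmatrix}1&0\\z^n/w(z)&1\end{pmatrix}^{-1}$ if $r<|z|<1$, $K=\begin{pmatrix}1&0\\1/(z^nw(z))&1\end{pmatrix}$ if $1<|z|<1/r$, and $K=I$ if $|z|<r$ or $|z|>1/r$; $N=\mathrm{diag}(D_e/\tau,\ \tau/D_e)$ if $|z|>1$ and $N=\begin{pmatrix}0&D_i/\tau\\-\tau/D_i&0\end{pmatrix}$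 if $|z|<1$. Moreover: (i) $\displaystyle \Phi_n(z)=\begin{cases}\tau^{-1}z^nD_e(z)S_{11}(n;z),&|z|>1/r,\\ \tau^{-1}z^nD_e(z)S_{11}(n;z)-\dfrac{\tau S_{12}(n;z)}{D_i(z)},&r<|z|<1/r,\\ -\dfrac{\tau S_{12}(n;z)}{D_i(z)},&|z|<r;\end{cases}$ (ii) $\overline{\alpha_n}=\tau^2\,S_{12}(n+1;0)$; (iii) $\kappa_n^2=\dfrac{\tau^2}{2\pi}\,S_{22}(n+1;0)$. -/

import Mathlib

open Filter Topology Polynomial Matrix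

noncomputable section

namespace OPUC

/-- A strictly positive analytic weight on the unit circle: a positive function that is the
restriction of a function holomorphic in a neighbourhood of the circle. -/
structure IsPositiveAnalyticWeight (w : Circle → ℝ) : Prop where
  pos : ∀ z, 0 < w z
  analytic : ∃ W : ℂ → ℂ, AnalyticOnNhd ℂ W (Metric.sphere (0 : ℂ) 1) ∧
    ∀ z : Circle, W (z : ℂ) = (w z : ℂ)

/-! ### Orthogonal polynomials on the unit circle -/

/-- The scalar product of two polynomials with respect to the measure `w(z) |dz|`, where `|dz|` is
arc length (total mass `2π`). -/
def scalarProduct (w : Circle → ℝ) (p q : ℂ[X]) : ℂ :=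
  ∫ θ in (0 : ℝ)..(2 * Real.pi),
    p.eval (Circle.exp θ : ℂ) * (starRingEnd ℂ) (q.eval (Circle.exp θ : ℂ)) *
      (w (Circle.exp θ) : ℂ)

/-- `φ` is the sequence of orthonormal polynomials: `φ n` has degree `n` and positive leading
coefficient, and the family is orthonormal with respect to `w(z) |dz|`. -/
structure IsOrthonormalSequence (w : Circle → ℝ) (φ : ℕ → ℂ[X]) : Prop where
  degree_eq : ∀ n, (φ n).degree = n
  leadingCoeff_im : ∀ n, (φ n).leadingCoeff.im = 0
  leadingCoeff_pos : ∀ n, 0 < (φ n).leadingCoeff.re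
  orthonormal : ∀ m n, scalarProduct w (φ n) (φ m) = if m = n then 1 else 0

/-- The leading coefficient `κ_n > 0` of the orthonormal polynomial of degree `n`. -/
def kappa (φ : ℕ → ℂ[X]) (n : ℕ) : ℝ := (φ n).leadingCoeff.re

/-- The monic orthogonal polynomial `Φ_n = φ_n / κ_n`. -/
def monicOPUC (φ : ℕ → ℂ[X]) (n : ℕ) : ℂ[X] := C ((kappa φ n : ℂ)⁻¹) * φ n

/-- The reversed polynomial `φ_n^*(z) = z^n conj (φ_n (1 / conj z))`. -/
def reversed (φ : ℕ → ℂ[X]) (n : ℕ) : ℂ[X] := ((φ n).map (starRingEnd ℂ)).reflect n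

/-- The Verblunsky coefficient `α_n = - conj (Φ_{n+1}(0))`. -/
def verblunsky (φ : ℕ → ℂ[X]) (n : ℕ) : ℂ :=
  -(starRingEnd ℂ) ((monicOPUC φ (n + 1)).eval 0)

/-! ### Szegő functions, critical radius and scattering function -/

/-- The Szegő function `D(w; z)`, meaningful for `|z| ≠ 1`. -/
def szego (w : Circle → ℝ) (z : ℂ) : ℂ :=
  Complex.exp ((1 / (4 * Real.pi) : ℂ) * ∫ θ in (0 : ℝ)..(2 * Real.pi),
    (Real.log (w (Circle.exp θ)) : ℂ) *
      (((Circle.exp θ : ℂ) + z) / ((Circle.exp θ : ℂ) - z)))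

/-- The constant `τ = 1 / D_i(w; 0) = D_e(w; ∞) > 0`. -/
def tau (w : Circle → ℝ) : ℝ :=
  Real.exp (-(1 / (4 * Real.pi)) * ∫ θ in (0 : ℝ)..(2 * Real.pi),
    Real.log (w (Circle.exp θ)))

/-- `F` is a holomorphic continuation of the exterior Szegő function to `|z| > s`. -/
def IsExteriorContinuation (w : Circle → ℝ) (s : ℝ) (F : ℂ → ℂ) : Prop :=
  DifferentiableOn ℂ F {z | s < ‖z‖} ∧ ∀ z : ℂ, 1 < ‖z‖ → F z = szego w z

/-- `F` is a holomorphic continuation of the reciprocal of the interior Szegő function to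
`|z| < R`. -/
def IsInvInteriorContinuation (w : Circle → ℝ) (R : ℝ) (F : ℂ → ℂ) : Prop :=
  DifferentiableOn ℂ F {z | ‖z‖ < R} ∧ ∀ z : ℂ, ‖z‖ < 1 → F z = (szego w z)⁻¹

/-- The critical radius `ρ`: the infimum of all `0 < s < 1` such that the exterior Szegő function
is holomorphic in `|z| > s`. -/
def criticalRadius (w : Circle → ℝ) : ℝ :=
  sInf {s : ℝ | 0 < s ∧ s < 1 ∧ ∃ F : ℂ → ℂ, IsExteriorContinuation w s F}

open Classical in
/-- The exterior Szegő function `D_e(w; z)`, continued holomorphically to `|z| > ρ`: its value at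
`z` is that of any holomorphic continuation to some `|z| > s` containing `z` (unique by the
identity theorem). It may have zeros in `ρ < |z| < 1`. -/
def szegoExt (w : Circle → ℝ) (z : ℂ) : ℂ :=
  if h : ∃ F : ℂ → ℂ, ∃ s : ℝ, 0 < s ∧ s < ‖z‖ ∧ IsExteriorContinuation w s F
  then h.choose z else 0

open Classical in
/-- The function `1 / D_i(w; z)`, continued holomorphically to `|z| < 1 / ρ`. -/
def invSzegoInt (w : Circle → ℝ) (z : ℂ) : ℂ :=
  if h : ∃ F : ℂ → ℂ, ∃ R : ℝ, 1 ≤ R ∧ ‖z‖ < R ∧ IsInvInteriorContinuation w R F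
  then h.choose z else 0

/-- The interior Szegő function `D_i(w; z)`, continued meromorphically to `|z| < 1 / ρ`: the
reciprocal of the holomorphic function `1 / D_i`. It may have poles in `1 < |z| < 1 / ρ`; there
Lean's value is `0`, and then `(szegoInt w z)⁻¹ = 0` is still the value of `1 / D_i`. -/
def szegoInt (w : Circle → ℝ) (z : ℂ) : ℂ := (invSzegoInt w z)⁻¹

/-- The weight continued meromorphically to `ρ < |z| < 1 / ρ` by `w = D_i / D_e`. -/
def weightExt (w : Circle → ℝ) (z : ℂ) : ℂ := szegoInt w z / szegoExt w z

/-- The scattering function `𝒮 = D_i D_e`, meromorphic in `ρ < |z| < 1 / ρ`. -/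
def scattering (w : Circle → ℝ) (z : ℂ) : ℂ := szegoInt w z * szegoExt w z

/-! ### The Cauchy operators and the Neumann series -/

/-- The exterior boundary value `f_-(t)` of `f` at a point `t` of the circle of radius `a`. -/
def exteriorValue (a : ℝ) (f : ℂ → ℂ) (t : ℂ) : ℂ := limUnder (𝓝[{z : ℂ | a < ‖z‖}] t) f

/-- The operator `M_n^i`, on the circle of radius `r`. -/
def cauchyInt (w : Circle → ℝ) (r : ℝ) (n : ℕ) (f : ℂ → ℂ) (z : ℂ) : ℂ :=
  -(1 / (2 * Real.pi * Complex.I * (tau w : ℂ) ^ 2)) *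
    ∮ t in C(0, r), exteriorValue r f t * (scattering w t * t ^ n / (t - z))

/-- The operator `M_n^e`, on the circle of radius `1 / r`. -/
def cauchyExt (w : Circle → ℝ) (r : ℝ) (n : ℕ) (f : ℂ → ℂ) (z : ℂ) : ℂ :=
  ((tau w : ℂ) ^ 2 / (2 * Real.pi * Complex.I)) *
    ∮ t in C(0, 1 / r), exteriorValue (1 / r) f t * (1 / (scattering w t * t ^ n * (t - z)))

/-- The iterates `f_n^{(0)} = 1`, `f_n^{(2k+1)} = M_n^i (f_n^{(2k)})`,
`f_n^{(2k+2)} = M_n^e (f_n^{(2k+1)})`. -/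
def iterF (w : Circle → ℝ) (r : ℝ) (n : ℕ) : ℕ → ℂ → ℂ
  | 0 => fun _ => 1
  | k + 1 => if Even k then cauchyInt w r n (iterF w r n k) else cauchyExt w r n (iterF w r n k)

/-- The iterates `g_n^{(0)} = 1`, `g_n^{(2k+1)} = M_n^e (g_n^{(2k)})`,
`g_n^{(2k+2)} = M_n^i (g_n^{(2k+1)})`. -/
def iterG (w : Circle → ℝ) (r : ℝ) (n : ℕ) : ℕ → ℂ → ℂ
  | 0 => fun _ => 1
  | k + 1 => if Even k then cauchyExt w r n (iterG w r n k) else cauchyInt w r n (iterG w r n k)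

/-- `S_11(n; z) = ∑ f_n^{(2k)}(z)`, for `|z| ≠ 1 / r`. -/
def S11 (w : Circle → ℝ) (r : ℝ) (n : ℕ) (z : ℂ) : ℂ := ∑' k, iterF w r n (2 * k) z

/-- `S_12(n; z) = ∑ f_n^{(2k+1)}(z)`, for `|z| ≠ r`. -/
def S12 (w : Circle → ℝ) (r : ℝ) (n : ℕ) (z : ℂ) : ℂ := ∑' k, iterF w r n (2 * k + 1) z

/-- `S_21(n; z) = ∑ g_n^{(2k+1)}(z)`, for `|z| ≠ 1 / r`. -/
def S21 (w : Circle → ℝ) (r : ℝ) (n : ℕ) (z : ℂ) : ℂ := ∑' k, iterG w r n (2 * k + 1) z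

/-- `S_22(n; z) = ∑ g_n^{(2k)}(z)`, for `|z| ≠ r`. -/
def S22 (w : Circle → ℝ) (r : ℝ) (n : ℕ) (z : ℂ) : ℂ := ∑' k, iterG w r n (2 * k) z

/-- The series `∑ u_k(z)` converges absolutely at every point of `A`, and uniformly on `A`. -/
def ConvergesAbsUniformlyOn (u : ℕ → ℂ → ℂ) (A : Set ℂ) : Prop :=
  (∀ z ∈ A, Summable fun k => ‖u k z‖) ∧
    TendstoUniformlyOn (fun N z => ∑ k ∈ Finset.range N, u k z) (fun z => ∑' k, u k z) atTop A

/-! ### The matrices of the Riemann–Hilbert analysis -/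

/-- The matrix `Y(z)`, for `n ≥ 1` and `|z| ≠ 1`, solving the Riemann–Hilbert problem of the
orthogonal polynomials. The Cauchy integrals are over the unit circle, parametrized by
`t = e^{iθ}`, `dt = i t dθ`. -/
def matY (w : Circle → ℝ) (φ : ℕ → ℂ[X]) (n : ℕ) (z : ℂ) : Matrix (Fin 2) (Fin 2) ℂ :=
  let cauchy (p : ℂ[X]) : ℂ := ∫ θ in (0 : ℝ)..(2 * Real.pi),
    p.eval (Circle.exp θ : ℂ) * (w (Circle.exp θ) : ℂ) /
      ((Circle.exp θ : ℂ) ^ n * ((Circle.exp θ : ℂ) - z)) * (Complex.I * (Circle.exp θ : ℂ))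
  !![(monicOPUC φ n).eval z,
      1 / (2 * Real.pi * Complex.I) * cauchy (monicOPUC φ n);
     -2 * Real.pi * (kappa φ (n - 1) : ℂ) * (reversed φ (n - 1)).eval z,
      -((kappa φ (n - 1) : ℂ) / Complex.I) * cauchy (reversed φ (n - 1))]

/-- The matrix `H(z)`, for `|z| ≠ 1`. -/
def matH (n : ℕ) (z : ℂ) : Matrix (Fin 2) (Fin 2) ℂ :=
  if 1 < ‖z‖ then !![(z ^ n)⁻¹, 0; 0, z ^ n] else 1

/-- The matrix `K(z)`, for `|z| ≠ r, 1, 1 / r`. -/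
def matK (w : Circle → ℝ) (r : ℝ) (n : ℕ) (z : ℂ) : Matrix (Fin 2) (Fin 2) ℂ :=
  if r < ‖z‖ ∧ ‖z‖ < 1 then !![1, 0; z ^ n / weightExt w z, 1]⁻¹
  else if 1 < ‖z‖ ∧ ‖z‖ < 1 / r then !![1, 0; 1 / (z ^ n * weightExt w z), 1]
  else 1

/-- The matrix `N(z)`, for `|z| ≠ 1`. -/
def matN (w : Circle → ℝ) (z : ℂ) : Matrix (Fin 2) (Fin 2) ℂ :=
  if 1 < ‖z‖ then !![szegoExt w z / tau w, 0; 0, tau w / szegoExt w z]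
  else !![0, szegoInt w z / tau w; -(tau w / szegoInt w z), 0]

end OPUC

end

open OPUC

open OPUC

namespace OPUC

/-! ### Cauchy integrals over circles centred at the origin -/

/-! Put D = D_e and V = 1/D_i, so that w = 1/(VD). Each row of S = YHKN⁻¹ comes from one polynomial
P and the Cauchy integral of P w t⁻ⁿ over the unit circle: P = Φ_n for the first row, P =
-2πκ_{n-1}φ*_{n-1} for the second. The factors H, K, N remove the jump on the unit circle. What
remains is a jump T₂·τ²/(𝒮tⁿ) of the first entry T₁ on |t| = 1/r and a jump -T₁·𝒮tⁿ/τ² of the second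
entry T₂ on |t| = r (interior minus exterior value). Orthogonality fixes the limits (α, β) of (T₁,
T₂) at infinity as (1, 0) and (0, 1), and Cauchy's formula gives T₁ = α + M^e T₂, T₂ = β + M^i T₁
(`IsSzegoPair.exists_row`).

Both kernels are geometrically small in n near their circles. Moving the contour away from z makes
the resulting bounds uniform up to the circle, so for large n each operator halves suprema
(`IsSzegoPair.exists_isHalving`). Iterating the two equations leaves a Neumann partial sum and a
remainder O(4⁻ᴺ) (`neumann_hasSum`). As T₁, T₂ are given explicitly, no uniqueness theorem for the
Riemann–Hilbert problem is needed. Each iterate is holomorphic across the next contour, so f_- is f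
itself (`iterF_succ_eq`, `iterG_succ_eq`). The formulas (i)–(iii) are read off from the explicit T₁,
T₂, the last two at z = 0, where V(0) = τ.

The analytic input is that log w extends to an annulus, so that D and V are exponentials near the
unit circle (`exists_szego_continuation`), and that reflection in the circle turns a continuation of
D to |z| > s into one of V to |z| < 1/s (`IsExteriorContinuation.reflect`). D may vanish on |t| = r
and V on |t| = 1/r, but there they occur in the kernels only as numerators. -/

/-- The open annulus `α < |z| < β`. -/
def annulus (α β : ℝ) : Set ℂ := {z | α < ‖z‖ ∧ ‖z‖ < β}

/-- The Cauchy integral of `h` over the circle `|t| = a`. -/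
noncomputable def cauchyTransform (a : ℝ) (h : ℂ → ℂ) (z : ℂ) : ℂ :=
  (2 * Real.pi * Complex.I)⁻¹ * ∮ t in C(0, a), h t / (t - z)

lemma isOpen_norm_gt (s : ℝ) : IsOpen {z : ℂ | s < ‖z‖} :=
  isOpen_lt continuous_const continuous_norm

lemma isOpen_norm_lt (s : ℝ) : IsOpen {z : ℂ | ‖z‖ < s} :=
  isOpen_lt continuous_norm continuous_const

lemma isOpen_annulus (α β : ℝ) : IsOpen (annulus α β) :=
  (isOpen_norm_gt α).inter (isOpen_norm_lt β)

lemma sphere_subset_annulus {α β a : ℝ} (h1 : α < a) (h2 : a < β) :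
    Metric.sphere (0 : ℂ) a ⊆ annulus α β := by
  intro z hz
  rw [mem_sphere_zero_iff_norm] at hz
  exact ⟨by rw [hz]; exact h1, by rw [hz]; exact h2⟩

lemma ne_of_norm_ne {z t : ℂ} (h : ‖t‖ ≠ ‖z‖) : t - z ≠ 0 :=
  fun h' => h (by rw [sub_eq_zero.mp h'])

lemma circleIntegral_eq_of_differentiableOn_annulus {f : ℂ → ℂ} {α β a a' : ℝ} (hα : 0 ≤ α)
    (hf : DifferentiableOn ℂ f (annulus α β)) (h1 : α < a) (h2 : a < β) (h1' : α < a')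
    (h2' : a' < β) : ∮ t in C(0, a), f t = ∮ t in C(0, a'), f t := by
  wlog h : a' ≤ a generalizing a a'
  · exact (this h1' h2' h1 h2 (le_of_not_ge h)).symm
  refine Complex.circleIntegral_eq_of_differentiable_on_annulus_off_countable (s := ∅)
    (hα.trans_lt h1') h Set.countable_empty (hf.continuousOn.mono ?_) ?_
  · rintro z ⟨hz, hz'⟩
    rw [mem_closedBall_zero_iff] at hz
    rw [mem_ball_zero_iff, not_lt] at hz'
    exact ⟨h1'.trans_le hz', hz.trans_lt h2⟩
  · rintro z ⟨⟨hz, hz'⟩, -⟩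
    rw [mem_ball_zero_iff] at hz
    rw [mem_closedBall_zero_iff, not_le] at hz'
    exact hf.differentiableAt ((isOpen_annulus α β).mem_nhds ⟨h1'.trans hz', hz.trans h2⟩)

lemma circleIntegral_eq_zero_of_differentiableOn_disc {f : ℂ → ℂ} {β a : ℝ} (ha : 0 ≤ a)
    (hf : DifferentiableOn ℂ f {z | ‖z‖ < β}) (h : a < β) : ∮ t in C(0, a), f t = 0 := by
  refine Complex.circleIntegral_eq_zero_of_differentiable_on_off_countable (s := ∅) ha
    Set.countable_empty (hf.continuousOn.mono ?_) ?_
  · intro z hz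
    rw [mem_closedBall_zero_iff] at hz
    exact hz.trans_lt h
  · rintro z ⟨hz, -⟩
    rw [mem_ball_zero_iff] at hz
    exact hf.differentiableAt ((isOpen_norm_lt β).mem_nhds (hz.trans h))

lemma continuousOn_div_sub {a : ℝ} {h : ℂ → ℂ} (hh : ContinuousOn h (Metric.sphere 0 a)) {z : ℂ}
    (hz : ‖z‖ ≠ a) : ContinuousOn (fun t => h t / (t - z)) (Metric.sphere 0 a) := by
  refine hh.div (by fun_prop) fun t ht => ne_of_norm_ne ?_
  rw [mem_sphere_zero_iff_norm] at ht
  rw [ht]; exact hz.symm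

lemma cauchyTransform_congr {a : ℝ} (ha : 0 ≤ a) {h h' : ℂ → ℂ} (hh : ∀ t, ‖t‖ = a → h t = h' t)
    (z : ℂ) : cauchyTransform a h z = cauchyTransform a h' z := by
  unfold cauchyTransform
  congr 1
  refine circleIntegral.integral_congr ha fun t ht => ?_
  rw [hh t (by simpa using ht)]

lemma cauchyTransform_sub {a : ℝ} (ha : 0 ≤ a) {h h' : ℂ → ℂ}
    (hh : ContinuousOn h (Metric.sphere 0 a)) (hh' : ContinuousOn h' (Metric.sphere 0 a)) {z : ℂ}
    (hz : ‖z‖ ≠ a) : cauchyTransform a (fun t => h t - h' t) z =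
      cauchyTransform a h z - cauchyTransform a h' z := by
  unfold cauchyTransform
  rw [← mul_sub, ← circleIntegral.integral_sub
    ((continuousOn_div_sub hh hz).circleIntegrable ha)
    ((continuousOn_div_sub hh' hz).circleIntegrable ha)]
  simp only [sub_div]

/-- With z on the same side of both circles the integrand has no pole between them. -/
lemma cauchyTransform_shift {a a' α β : ℝ} (hα : 0 ≤ α) {h : ℂ → ℂ}
    (hh : DifferentiableOn ℂ h (annulus α β)) (h1 : α < a) (h2 : a < β) (h1' : α < a')
    (h2' : a' < β) {z : ℂ} (hz : (‖z‖ < a ∧ ‖z‖ < a') ∨ (a < ‖z‖ ∧ a' < ‖z‖)) :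
    cauchyTransform a h z = cauchyTransform a' h z := by
  unfold cauchyTransform
  congr 1
  rcases hz with ⟨hz, hz'⟩ | ⟨hz, hz'⟩
  · refine circleIntegral_eq_of_differentiableOn_annulus (α := max α ‖z‖) (β := β)
      (hα.trans (le_max_left _ _)) ?_ (max_lt h1 hz) h2 (max_lt h1' hz') h2'
    refine (hh.mono fun t ht => ⟨(le_max_left _ _).trans_lt ht.1, ht.2⟩).div (by fun_prop)
      fun t ht => ne_of_norm_ne ((le_max_right _ _).trans_lt ht.1).ne'
  · refine circleIntegral_eq_of_differentiableOn_annulus (α := α) (β := min β ‖z‖)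
      hα ?_ h1 (lt_min h2 hz) h1' (lt_min h2' hz')
    refine (hh.mono fun t ht => ⟨ht.1, ht.2.trans_le (min_le_left _ _)⟩).div (by fun_prop)
      fun t ht => ne_of_norm_ne (ht.2.trans_le (min_le_right _ _)).ne

lemma cauchyTransform_const_of_lt {a : ℝ} {z : ℂ} (hz : ‖z‖ < a) (c : ℂ) :
    cauchyTransform a (fun _ => c) z = c := by
  have h := circleIntegral.integral_sub_inv_of_mem_ball (c := 0) (w := z) (R := a) (by simpa using hz)
  unfold cauchyTransform
  simp only [div_eq_mul_inv]
  rw [circleIntegral.integral_const_mul, h]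
  have : (2 * Real.pi * Complex.I : ℂ) ≠ 0 := Complex.two_pi_I_ne_zero
  field_simp

lemma cauchyTransform_eq_zero_of_gt {a β : ℝ} (ha : 0 ≤ a) {h : ℂ → ℂ}
    (hh : DifferentiableOn ℂ h {z | ‖z‖ < β}) (hβ : a < β) {z : ℂ} (hz : a < ‖z‖) :
    cauchyTransform a h z = 0 := by
  unfold cauchyTransform
  rw [circleIntegral_eq_zero_of_differentiableOn_disc (β := min β ‖z‖) ha ?_ (lt_min hβ hz),
    mul_zero]
  refine (hh.mono fun t ht => lt_of_lt_of_le ht (min_le_left _ _)).div (by fun_prop)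
    fun t ht => ne_of_norm_ne (lt_of_lt_of_le ht (min_le_right _ _)).ne

/-- `dslope h z` is holomorphic through z, so its integrals over the two circles agree. Only the
constant density `h z` contributes to the difference: `h z` from the outer circle, 0 from the inner
one. -/
lemma cauchyTransform_jump {a₁ a₂ α β : ℝ} (hα : 0 ≤ α) {h : ℂ → ℂ}
    (hh : DifferentiableOn ℂ h (annulus α β)) (h1 : α < a₁) (h2 : a₂ < β) {z : ℂ}
    (hz1 : a₁ < ‖z‖) (hz2 : ‖z‖ < a₂) :
    cauchyTransform a₂ h z - cauchyTransform a₁ h z = h z := by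
  have ha₁ : 0 ≤ a₁ := hα.trans h1.le
  have ha₂ : 0 ≤ a₂ := (norm_nonneg z).trans hz2.le
  have hzm : annulus α β ∈ 𝓝 z :=
    (isOpen_annulus α β).mem_nhds ⟨h1.trans hz1, hz2.trans h2⟩
  have hd : DifferentiableOn ℂ (dslope h z) (annulus α β) :=
    (Complex.differentiableOn_dslope hzm).2 hh
  have key : ∀ a, 0 ≤ a → α < a → a < β → ‖z‖ ≠ a →
      cauchyTransform a h z - cauchyTransform a (fun _ => h z) z =
        (2 * Real.pi * Complex.I)⁻¹ * ∮ t in C(0, a), dslope h z t := by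
    intro a ha h1a h2a hza
    rw [← cauchyTransform_sub ha (hh.continuousOn.mono (sphere_subset_annulus h1a h2a))
      continuousOn_const hza]
    unfold cauchyTransform
    congr 1
    refine circleIntegral.integral_congr ha fun t ht => ?_
    have htz : t ≠ z := by
      rintro rfl
      exact hza (by simpa using ht)
    simp only [dslope_of_ne _ htz, slope_def_field]
  have k1 := key a₁ ha₁ h1 (hz1.trans (hz2.trans h2)) hz1.ne'
  have k2 := key a₂ ha₂ (h1.trans (hz1.trans hz2)) h2 hz2.ne
  rw [cauchyTransform_const_of_lt hz2] at k2
  rw [cauchyTransform_eq_zero_of_gt ha₁ (β := ‖z‖) (differentiableOn_const _) hz1 hz1, sub_zero]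
    at k1
  rw [k1, circleIntegral_eq_of_differentiableOn_annulus hα hd h1 (hz1.trans (hz2.trans h2))
    (h1.trans (hz1.trans hz2)) h2, ← k2]
  ring

lemma cauchyTransform_eq_of_lt {a β : ℝ} {h : ℂ → ℂ}
    (hh : DifferentiableOn ℂ h {z | ‖z‖ < β}) (hβ : a < β) {z : ℂ} (hz : ‖z‖ < a) :
    cauchyTransform a h z = h z := by
  have := Complex.two_pi_I_inv_smul_circleIntegral_sub_inv_smul_of_differentiable_on_off_countable
    (R := a) (c := 0) (w := z) (f := h) (s := ∅) Set.countable_empty (by simpa using hz)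
    (hh.continuousOn.mono fun t ht => by
      rw [mem_closedBall_zero_iff] at ht
      exact ht.trans_lt hβ)
    (fun t ht => hh.differentiableAt ((isOpen_norm_lt β).mem_nhds (by
      have := ht.1
      rw [mem_ball_zero_iff] at this
      exact this.trans hβ)))
  rw [← this]
  simp only [cauchyTransform, smul_eq_mul, div_eq_mul_inv]
  congr 2
  ext t
  ring

lemma norm_cauchyTransform_le {a d M : ℝ} (ha : 0 ≤ a) (hd : 0 < d) {h : ℂ → ℂ} {z : ℂ}
    (hh : ∀ t, ‖t‖ = a → ‖h t‖ ≤ M) (hz : ∀ t, ‖t‖ = a → d ≤ ‖t - z‖) :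
    ‖cauchyTransform a h z‖ ≤ a * (M / d) := by
  unfold cauchyTransform
  rw [← smul_eq_mul]
  refine circleIntegral.norm_two_pi_i_inv_smul_integral_le_of_norm_le_const ha fun t ht => ?_
  have ht' : ‖t‖ = a := by simpa using ht
  have hM : 0 ≤ M := (norm_nonneg _).trans (hh t ht')
  rw [norm_div]
  exact div_le_div₀ hM (hh t ht') hd (hz t ht')

lemma tendsto_cauchyTransform_zero {a : ℝ} (ha : 0 ≤ a) {h : ℂ → ℂ}
    (hh : ContinuousOn h (Metric.sphere 0 a)) :
    Tendsto (cauchyTransform a h) (Bornology.cobounded ℂ) (𝓝 0) := by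
  obtain ⟨M, hM⟩ := (isCompact_sphere (0 : ℂ) a).exists_bound_of_continuousOn hh
  have hlim : Tendsto (fun z : ℂ => a * (M / (‖z‖ - a))) (Bornology.cobounded ℂ) (𝓝 (a * 0)) := by
    refine Tendsto.const_mul _ (Tendsto.const_div_atTop ?_ _)
    exact tendsto_atTop_add_const_right _ _ tendsto_norm_cobounded_atTop
  rw [mul_zero] at hlim
  refine squeeze_zero_norm' ?_ hlim
  filter_upwards [tendsto_norm_cobounded_atTop.eventually_gt_atTop a] with z hz
  refine norm_cauchyTransform_le ha (sub_pos.2 hz) (fun t ht => hM t (by simpa using ht))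
    fun t ht => ?_
  rw [← ht, norm_sub_rev]
  exact norm_sub_norm_le _ _

/-- The circle is pushed to infinity, where h is uniformly close to c. -/
lemma cauchyTransform_exterior_of_lt {a α : ℝ} (hα : 0 ≤ α) (h1 : α < a) {h : ℂ → ℂ} {c : ℂ}
    (hh : DifferentiableOn ℂ h {z | α < ‖z‖}) (hc : Tendsto h (Bornology.cobounded ℂ) (𝓝 c))
    {z : ℂ} (hz : ‖z‖ < a) : cauchyTransform a h z = c := by
  have hsph : ∀ b, α < b → ContinuousOn h (Metric.sphere 0 b) := fun b hb =>
    hh.continuousOn.mono fun t ht => by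
      rw [mem_sphere_zero_iff_norm] at ht
      exact hb.trans_eq ht.symm
  refine eq_of_sub_eq_zero (norm_eq_zero.1 (le_antisymm (le_of_forall_pos_le_add fun ε hε => ?_)
    (norm_nonneg _)))
  have hev := (Metric.tendsto_nhds.1 hc) (ε / 2) (half_pos hε)
  rw [← Metric.comap_dist_right_atTop (0 : ℂ)] at hev
  obtain ⟨R, hR⟩ := eventually_atTop.1 (eventually_comap.1 hev)
  set b := max (max R a) (2 * ‖z‖ + 1) with hb
  have hba : a ≤ b := (le_max_right R a).trans (le_max_left _ _)
  have hbR : R ≤ b := (le_max_left R a).trans (le_max_left _ _)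
  -- This makes |t - z| ≥ b/2 on |t| = b, so the error is at most b·(ε/2)/(b/2) = ε.
  have hbz : 2 * ‖z‖ + 1 ≤ b := le_max_right _ _
  have hb0 : 0 ≤ b := by linarith [norm_nonneg z]
  rw [cauchyTransform_shift hα (hh.mono fun t (ht : t ∈ annulus α (b + 1)) => ht.1) h1
    (by linarith) (h1.trans_le hba) (by linarith) (Or.inl ⟨hz, hz.trans_le hba⟩)]
  rw [← cauchyTransform_const_of_lt (hz.trans_le hba) c,
    ← cauchyTransform_sub hb0 (hsph b (h1.trans_le hba)) continuousOn_const
      (hz.trans_le hba).ne]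
  have hbp : 0 < b := by linarith [norm_nonneg z]
  refine (norm_cauchyTransform_le (M := ε / 2) (d := b / 2) hb0 (by linarith)
    (fun t ht => ?_) fun t ht => ?_).trans ?_
  · have := hR b hbR t (by simpa using ht)
    rw [dist_eq_norm] at this
    exact this.le
  · have := norm_sub_norm_le t z
    rw [ht] at this
    linarith [norm_nonneg z]
  · rw [zero_add]
    apply le_of_eq
    field_simp

lemma cauchyTransform_exterior_of_gt {a α : ℝ} (hα : 0 ≤ α) (h1 : α < a) {h : ℂ → ℂ} {c : ℂ}
    (hh : DifferentiableOn ℂ h {z | α < ‖z‖}) (hc : Tendsto h (Bornology.cobounded ℂ) (𝓝 c))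
    {z : ℂ} (hz : a < ‖z‖) : cauchyTransform a h z = c - h z := by
  have h2 := cauchyTransform_jump (a₁ := a) (a₂ := ‖z‖ + 1) (β := ‖z‖ + 2) hα
    (hh.mono fun t ht => ht.1) h1 (by linarith) hz (by linarith)
  rw [cauchyTransform_exterior_of_lt hα (by linarith) hh hc (by linarith)] at h2
  rw [← h2]; ring

lemma differentiableOn_cauchyTransform {a : ℝ} (ha : 0 ≤ a) {h : ℂ → ℂ}
    (hh : ContinuousOn h (Metric.sphere 0 a)) :
    DifferentiableOn ℂ (cauchyTransform a h) {z | ‖z‖ ≠ a} := by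
  intro z hz
  refine DifferentiableAt.differentiableWithinAt ?_
  refine DifferentiableAt.const_mul ?_ _
  obtain ⟨M, hM⟩ := (isCompact_sphere (0 : ℂ) a).exists_bound_of_continuousOn hh
  -- Half the distance from z to the circle: every point of the ball of radius d around z keeps
  -- distance d from the contour, which dominates the differentiated integrand.
  set d := |‖z‖ - a| / 2 with hd
  have hdpos : 0 < d := half_pos (abs_pos.2 (sub_ne_zero.2 hz))
  have hdist : ∀ x ∈ Metric.ball z d, ∀ t : ℂ, ‖t‖ = a → d ≤ ‖t - x‖ := by
    intro x hx t ht
    rw [mem_ball_iff_norm] at hx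
    have e1 : |‖z‖ - ‖t‖| ≤ ‖z - t‖ := abs_norm_sub_norm_le z t
    rw [ht] at e1
    have e2 : ‖z - t‖ ≤ ‖x - z‖ + ‖t - x‖ := by
      rw [norm_sub_rev x z]
      have := norm_add_le (z - x) (x - t)
      rw [norm_sub_rev x t] at this
      simpa using this
    linarith [hd]
  have hcm : ∀ θ, ‖circleMap 0 a θ‖ = a := fun θ => by
    simp [abs_of_nonneg ha]
  have hcont : ContinuousOn (fun θ => h (circleMap 0 a θ)) Set.univ :=
    hh.comp (continuous_circleMap 0 a).continuousOn fun θ _ => circleMap_mem_sphere 0 ha θ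
  rw [continuousOn_univ] at hcont
  have hne : ∀ x ∈ Metric.ball z d, ∀ θ, circleMap 0 a θ - x ≠ 0 := fun x hx θ h0 => by
    have := hdist x hx _ (hcm θ)
    rw [h0, norm_zero] at this
    linarith
  have hcF : ∀ x ∈ Metric.ball z d, Continuous fun θ : ℝ =>
      deriv (circleMap 0 a) θ • (h (circleMap 0 a θ) / (circleMap 0 a θ - x)) := by
    intro x hx
    simp only [deriv_circleMap, smul_eq_mul]
    exact ((continuous_circleMap 0 a).mul continuous_const).mul
      (hcont.div ((continuous_circleMap 0 a).sub continuous_const) (hne x hx))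
  have hz0 : z ∈ Metric.ball z d := Metric.mem_ball_self hdpos
  unfold circleIntegral
  refine (intervalIntegral.hasDerivAt_integral_of_dominated_loc_of_deriv_le
    (F' := fun x θ => deriv (circleMap 0 a) θ • (h (circleMap 0 a θ) / (circleMap 0 a θ - x) ^ 2))
    (s := Metric.ball z d) (bound := fun _ => a * (M / d ^ 2)) (Metric.ball_mem_nhds z hdpos)
    ?_ ((hcF z hz0).intervalIntegrable _ _) ?_ ?_ intervalIntegrable_const ?_).2.differentiableAt
  · filter_upwards [Metric.ball_mem_nhds z hdpos] with x hx
    exact (hcF x hx).aestronglyMeasurable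
  · refine Continuous.aestronglyMeasurable ?_
    simp only [deriv_circleMap, smul_eq_mul]
    exact ((continuous_circleMap 0 a).mul continuous_const).mul
      (hcont.div (((continuous_circleMap 0 a).sub continuous_const).pow 2)
        fun θ => pow_ne_zero 2 (hne z hz0 θ))
  · refine Eventually.of_forall fun θ _ x hx => ?_
    have hMθ := hM _ (circleMap_mem_sphere 0 ha θ)
    rw [norm_smul, norm_div, norm_pow, deriv_circleMap, norm_mul, hcm, Complex.norm_I, mul_one]
    refine mul_le_mul_of_nonneg_left ?_ ha
    exact div_le_div₀ ((norm_nonneg _).trans hMθ) hMθ (by positivity)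
      (pow_le_pow_left₀ hdpos.le (hdist x hx _ (hcm θ)) 2)
  · refine Eventually.of_forall fun θ _ x hx => ?_
    have := ((((hasDerivAt_id x).const_sub (circleMap 0 a θ)).inv (hne x hx θ)).const_mul
      (h (circleMap 0 a θ))).const_mul (deriv (circleMap 0 a) θ)
    simpa [div_eq_mul_inv] using this

/-- A Cauchy integral is bounded up to its contour when the density is holomorphic around it. -/
lemma norm_cauchyTransform_le_of_annulus {a a₁ a₂ α β d M : ℝ} (hα : 0 ≤ α) (hd : 0 < d)
    {h : ℂ → ℂ} (hh : DifferentiableOn ℂ h (annulus α β)) (h1 : α < a₁) (h2 : a₂ < β)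
    (hd1 : a₁ + d ≤ a) (hd2 : a + d ≤ a₂) (hM : ∀ t, a₁ ≤ ‖t‖ → ‖t‖ ≤ a₂ → ‖h t‖ ≤ M)
    {z : ℂ} (hz : ‖z‖ ≠ a) : ‖cauchyTransform a h z‖ ≤ a₂ / d * M := by
  have hM0 : 0 ≤ M := (norm_nonneg _).trans (hM a₁ (by
    rw [Complex.norm_real]; exact le_abs_self _) (by
    rw [Complex.norm_real, Real.norm_of_nonneg (by linarith)]; linarith))
  -- The contour moves away from z: outwards for z inside, inwards for z outside. The new circle is
  -- at distance at least d from z, however close z is to the original one.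
  rcases hz.lt_or_gt with hz | hz
  · rw [cauchyTransform_shift (a' := a₂) hα hh (by linarith) (by linarith) (by linarith) h2
      (Or.inl ⟨hz, by linarith⟩)]
    refine (norm_cauchyTransform_le (by linarith) hd (fun t ht => hM t (by linarith) ht.le)
      fun t ht => ?_).trans_eq (by ring)
    have := norm_sub_norm_le t z
    linarith
  · rw [cauchyTransform_shift (a' := a₁) hα hh (by linarith) (by linarith) h1 (by linarith)
      (Or.inr ⟨hz, by linarith⟩)]
    refine (norm_cauchyTransform_le (by linarith) hd (fun t ht => hM t ht.ge (by linarith))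
      fun t ht => ?_).trans ?_
    · have := norm_sub_norm_le z t
      rw [norm_sub_rev] at this
      linarith
    · rw [div_mul_eq_mul_div, ← mul_div_assoc]
      exact div_le_div_of_nonneg_right (mul_le_mul_of_nonneg_right (by linarith) hM0) hd.le

/-! ### Holomorphic continuation of the Szegő functions -/

lemma coe_circle_exp (θ : ℝ) : (Circle.exp θ : ℂ) = circleMap 0 1 θ := by
  simp [circleMap, Circle.coe_exp]

/-- W is positive on the compact circle, hence stays in the slit plane on a thin annulus, where the
principal logarithm applies. -/
lemma IsPositiveAnalyticWeight.exists_log {w : Circle → ℝ} (hw : IsPositiveAnalyticWeight w) :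
    ∃ (δ : ℝ) (ℓ : ℂ → ℂ), 0 < δ ∧ δ < 1 ∧ DifferentiableOn ℂ ℓ (annulus (1 - δ) (1 + δ)) ∧
      ∀ z : Circle, ℓ z = (Real.log (w z) : ℂ) := by
  obtain ⟨W, hW, hWw⟩ := hw.analytic
  have hsub : Metric.sphere (0 : ℂ) 1 ⊆
      interior {z | AnalyticAt ℂ W z ∧ W z ∈ Complex.slitPlane} := by
    intro z hz
    rw [mem_interior_iff_mem_nhds]
    have hz' : W z ∈ Complex.slitPlane := by
      have := hWw ⟨z, hz⟩
      rw [this, Complex.ofReal_mem_slitPlane]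
      exact hw.pos _
    exact (hW z hz).eventually_analyticAt.and
      ((hW z hz).continuousAt.eventually (Complex.isOpen_slitPlane.mem_nhds hz'))
  obtain ⟨δ, hδ, hδU⟩ := (isCompact_sphere (0 : ℂ) 1).exists_thickening_subset_open
    isOpen_interior hsub
  refine ⟨min δ (1 / 2), fun z => Complex.log (W z), by positivity,
    (min_le_right _ _).trans_lt (by norm_num), fun z hz => ?_, fun z => ?_⟩
  · have hz1 := hz.1
    have hz2 := hz.2
    have hm1 := min_le_left δ (1 / 2)
    have hm2 := min_le_right δ (1 / 2)
    have hz0 : 0 < ‖z‖ := by linarith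
    have hmem : z ∈ Metric.thickening δ (Metric.sphere (0 : ℂ) 1) := by
      refine Metric.mem_thickening_iff.2 ⟨(‖z‖⁻¹ : ℝ) • z, ?_, ?_⟩
      · rw [mem_sphere_zero_iff_norm, norm_smul, Real.norm_of_nonneg (by positivity),
          inv_mul_cancel₀ hz0.ne']
      · have : z - (‖z‖⁻¹ : ℝ) • z = ((‖z‖ - 1) * ‖z‖⁻¹ : ℝ) • z := by
          rw [sub_mul, mul_inv_cancel₀ hz0.ne', sub_smul, one_mul, one_smul]
        rw [dist_eq_norm, this, norm_smul, norm_mul, norm_inv, norm_norm, mul_assoc,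
          inv_mul_cancel₀ hz0.ne', mul_one, Real.norm_eq_abs, abs_lt]
        constructor <;> linarith
    obtain ⟨ha, hs⟩ := interior_subset (hδU hmem)
    exact (ha.differentiableAt.clog hs).differentiableWithinAt
  · simp only
    rw [hWw, ← Complex.ofReal_log (hw.pos z).le]

/-- With t = e^{iθ}, (t + z)/(t - z) dθ = (2/i) dt/(t - z) - dθ. The first term gives the Cauchy
integral of log w, the second the factor τ. -/
lemma szego_eq_exp {w : Circle → ℝ} {ℓ : ℂ → ℂ} (hc : ContinuousOn ℓ (Metric.sphere 0 1))
    (hℓ : ∀ z : Circle, ℓ z = (Real.log (w z) : ℂ)) {z : ℂ} (hz : ‖z‖ ≠ 1) :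
    szego w z = Complex.exp (cauchyTransform 1 ℓ z) * tau w := by
  have hcℓ : Continuous fun θ => ℓ (circleMap 0 1 θ) := by
    rw [← continuousOn_univ]
    exact hc.comp (continuous_circleMap 0 1).continuousOn
      fun θ _ => circleMap_mem_sphere 0 zero_le_one θ
  have hne : ∀ θ, circleMap 0 1 θ - z ≠ 0 := fun θ => ne_of_norm_ne (by simpa using hz.symm)
  have hl : ∀ θ : ℝ, (Real.log (w (Circle.exp θ)) : ℂ) = ℓ (circleMap 0 1 θ) := fun θ => by
    rw [← hℓ, coe_circle_exp]
  have htau : (tau w : ℂ) = Complex.exp (-(1 / (4 * Real.pi)) *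
      ∫ θ in (0 : ℝ)..(2 * Real.pi), ℓ (circleMap 0 1 θ)) := by
    rw [tau, Complex.ofReal_exp]
    congr 1
    push_cast
    rw [← intervalIntegral.integral_ofReal]
    simp only [hl]
  rw [szego, htau, ← Complex.exp_add]
  congr 1
  have hpt : ∀ θ : ℝ, (Real.log (w (Circle.exp θ)) : ℂ) *
      (((Circle.exp θ : ℂ) + z) / ((Circle.exp θ : ℂ) - z)) =
      (2 / Complex.I) * (deriv (circleMap 0 1) θ • (ℓ (circleMap 0 1 θ) / (circleMap 0 1 θ - z)))
        - ℓ (circleMap 0 1 θ) := by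
    intro θ
    rw [hl, coe_circle_exp, deriv_circleMap, smul_eq_mul]
    have := hne θ
    field_simp
    ring
  simp only [hpt]
  rw [intervalIntegral.integral_sub, intervalIntegral.integral_const_mul, cauchyTransform,
    circleIntegral]
  · have hpi : (Real.pi : ℂ) ≠ 0 := by exact_mod_cast Real.pi_ne_zero
    field_simp
    ring
  · refine Continuous.intervalIntegrable ?_ _ _
    simp only [deriv_circleMap, smul_eq_mul]
    exact continuous_const.mul (((continuous_circleMap 0 1).mul continuous_const).mul
      (hcℓ.div ((continuous_circleMap 0 1).sub continuous_const) hne))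
  · exact hcℓ.intervalIntegrable _ _

lemma szego_zero (w : Circle → ℝ) : szego w 0 = (tau w : ℂ)⁻¹ := by
  rw [szego, tau, Complex.ofReal_exp, ← Complex.exp_neg]
  congr 1
  push_cast
  rw [neg_mul, neg_neg, ← intervalIntegral.integral_ofReal]
  simp

lemma tau_ne_zero (w : Circle → ℝ) : (tau w : ℂ) ≠ 0 :=
  Complex.ofReal_ne_zero.2 (Real.exp_ne_zero _)

-- On the circle the conjugate of t is 1/t, so conjugation together with reflection of z changes the
-- sign of the kernel (t + z)/(t - z).
open ComplexConjugate in
lemma szego_conj_inv (w : Circle → ℝ) {z : ℂ} (h0 : z ≠ 0) (h1 : ‖z‖ ≠ 1) :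
    conj (szego w (conj z)⁻¹) = (szego w z)⁻¹ := by
  rw [szego, szego, ← Complex.exp_conj, ← Complex.exp_neg]
  congr 1
  rw [map_mul, intervalIntegral.integral_of_le (by positivity),
    intervalIntegral.integral_of_le (by positivity), ← integral_conj, ← mul_neg,
    ← MeasureTheory.integral_neg]
  congr 1
  · rw [← Complex.ofReal_one, ← Complex.ofReal_ofNat, ← Complex.ofReal_mul, ← Complex.ofReal_div,
      Complex.conj_ofReal]
  · congr 1
    ext θ
    have he : conj (Circle.exp θ : ℂ) = (Circle.exp θ : ℂ)⁻¹ := by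
      rw [← Circle.coe_inv_eq_conj, Circle.coe_inv]
    have hne : (Circle.exp θ : ℂ) - z ≠ 0 := ne_of_norm_ne (by simpa using h1.symm)
    have hne' : z - (Circle.exp θ : ℂ) ≠ 0 := by rwa [← neg_sub, neg_ne_zero]
    have hee : (Circle.exp θ : ℂ) ≠ 0 := Circle.coe_ne_zero _
    simp only [map_mul, map_div₀, map_add, map_sub, map_inv₀, Complex.conj_conj,
      Complex.conj_ofReal, he]
    rw [← mul_neg]
    congr 1
    have e1 : (Circle.exp θ : ℂ)⁻¹ - z⁻¹ = (z - Circle.exp θ) / (Circle.exp θ * z) := by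
      field_simp
    rw [e1]
    field_simp
    rw [← neg_sub]
    field_simp
    ring

/-- The exponents are Cauchy integrals of log w. Moving the contour to 1 - δ/2 or 1 + δ/2 continues
them across the unit circle, and their jump there is log w. The exponential form also excludes zeros
near the circle. -/
lemma exists_szego_continuation {w : Circle → ℝ} (hw : IsPositiveAnalyticWeight w) :
    ∃ (a b : ℝ) (Qe Qi : ℂ → ℂ), 0 < a ∧ a < 1 ∧ 1 < b ∧
      DifferentiableOn ℂ Qe {z | a < ‖z‖} ∧ DifferentiableOn ℂ Qi {z | ‖z‖ < b} ∧
      (∀ z, 1 < ‖z‖ → szego w z = Complex.exp (Qe z)) ∧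
      (∀ z, ‖z‖ < 1 → szego w z = Complex.exp (Qi z)) ∧
      (∀ z : Circle, Qi z - Qe z = (Real.log (w z) : ℂ)) ∧
      Tendsto (szego w) (Bornology.cobounded ℂ) (𝓝 (tau w)) := by
  obtain ⟨δ, ℓ, hδ, hδ1, hd, hℓ⟩ := hw.exists_log
  have hsph : ∀ c, 1 - δ < c → c < 1 + δ → ContinuousOn ℓ (Metric.sphere 0 c) := fun c h1 h2 =>
    hd.continuousOn.mono (sphere_subset_annulus h1 h2)
  have hδ0 : 0 ≤ 1 - δ := by linarith
  have htau : (tau w : ℂ) = Complex.exp (Real.log (tau w)) := by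
    rw [← Complex.ofReal_exp, Real.exp_log (show 0 < tau w from Real.exp_pos _)]
  have hs1 := hsph 1 (by linarith) (by linarith)
  refine ⟨1 - δ / 2, 1 + δ / 2, fun z => cauchyTransform (1 - δ / 2) ℓ z + Real.log (tau w),
    fun z => cauchyTransform (1 + δ / 2) ℓ z + Real.log (tau w), by linarith, by linarith,
    by linarith, ?_, ?_, ?_, ?_, ?_, ?_⟩
  · exact ((differentiableOn_cauchyTransform (by linarith) (hsph _ (by linarith)
      (by linarith))).mono fun z hz => ne_of_gt hz).add_const _
  · exact ((differentiableOn_cauchyTransform (by linarith) (hsph _ (by linarith)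
      (by linarith))).mono fun z hz => ne_of_lt hz).add_const _
  · intro z hz
    rw [szego_eq_exp hs1 hℓ hz.ne', Complex.exp_add, ← htau,
      cauchyTransform_shift (a' := 1 - δ / 2) hδ0 hd (by linarith) (by linarith) (by linarith)
        (by linarith) (Or.inr ⟨hz, by linarith⟩)]
  · intro z hz
    rw [szego_eq_exp hs1 hℓ hz.ne, Complex.exp_add, ← htau,
      cauchyTransform_shift (a' := 1 + δ / 2) hδ0 hd (by linarith) (by linarith) (by linarith)
        (by linarith) (Or.inl ⟨hz, by linarith⟩)]
  · intro z
    rw [add_sub_add_right_eq_sub, cauchyTransform_jump hδ0 hd (by linarith) (by linarith)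
      (by rw [Circle.norm_coe]; linarith) (by rw [Circle.norm_coe]; linarith), hℓ]
  · have h := (Complex.continuous_exp.tendsto 0).comp
      (tendsto_cauchyTransform_zero zero_le_one hs1)
    have h' := h.mul_const (tau w : ℂ)
    rw [Complex.exp_zero, one_mul] at h'
    refine h'.congr' ?_
    filter_upwards [tendsto_norm_cobounded_atTop.eventually_gt_atTop 1] with z hz
    rw [szego_eq_exp hs1 hℓ hz.ne']
    rfl

lemma isPreconnected_norm_gt {s : ℝ} (hs : 0 ≤ s) : IsPreconnected {z : ℂ | s < ‖z‖} := by
  have : {z : ℂ | s < ‖z‖} =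
      (fun p : ℝ × ℝ => (p.1 : ℂ) * Complex.exp (p.2 * Complex.I)) '' (Set.Ioi s ×ˢ Set.univ) := by
    ext z
    constructor
    · intro hz
      exact ⟨(‖z‖, z.arg), ⟨hz, trivial⟩, Complex.norm_mul_exp_arg_mul_I z⟩
    · rintro ⟨⟨ρ, θ⟩, ⟨hρ, -⟩, rfl⟩
      have hρ' : s < ρ := hρ
      simpa [abs_of_pos (hs.trans_lt hρ')] using hρ'
  rw [this]
  exact (isPreconnected_Ioi.prod isPreconnected_univ).image _ (by fun_prop)

lemma eqOn_of_isExteriorContinuation {w : Circle → ℝ} {s s' : ℝ} {F F' : ℂ → ℂ}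
    (hF : IsExteriorContinuation w s F) (hF' : IsExteriorContinuation w s' F') {z : ℂ}
    (hs : 0 ≤ s) (h : s < ‖z‖) (h' : s' < ‖z‖) : F z = F' z := by
  have hU := isOpen_norm_gt (max s s')
  have h1 : DifferentiableOn ℂ F {z | max s s' < ‖z‖} :=
    hF.1.mono fun t (ht : _ < ‖t‖) => lt_of_le_of_lt (le_max_left s s') ht
  have h2 : DifferentiableOn ℂ F' {z | max s s' < ‖z‖} :=
    hF'.1.mono fun t (ht : _ < ‖t‖) => lt_of_le_of_lt (le_max_right s s') ht
  set R : ℝ := max (max s s') 1 + 1 with hR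
  have hR1 : max s s' < R := (le_max_left _ _).trans_lt (lt_add_one _)
  have hR2 : 1 < R := (le_max_right _ _).trans_lt (lt_add_one _)
  have hRn : ‖(R : ℂ)‖ = R := by rw [Complex.norm_real, Real.norm_of_nonneg (by linarith)]
  refine (h1.analyticOnNhd hU).eqOn_of_preconnected_of_eventuallyEq (h2.analyticOnNhd hU)
    (isPreconnected_norm_gt (hs.trans (le_max_left _ _))) (z₀ := (R : ℂ)) (hR1.trans_eq hRn.symm) ?_
    (max_lt h h')
  filter_upwards [(isOpen_norm_gt 1).mem_nhds (show (R : ℂ) ∈ {z : ℂ | 1 < ‖z‖} from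
    hR2.trans_eq hRn.symm)] with t ht
  rw [hF.2 t ht, hF'.2 t ht]

lemma eqOn_of_isInvInteriorContinuation {w : Circle → ℝ} {R R' : ℝ} {F F' : ℂ → ℂ}
    (hF : IsInvInteriorContinuation w R F) (hF' : IsInvInteriorContinuation w R' F') {z : ℂ}
    (h : ‖z‖ < R) (h' : ‖z‖ < R') : F z = F' z := by
  have hU := isOpen_norm_lt (min R R')
  have h1 : DifferentiableOn ℂ F {z | ‖z‖ < min R R'} :=
    hF.1.mono fun t (ht : ‖t‖ < _) => lt_of_lt_of_le ht (min_le_left _ _)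
  have h2 : DifferentiableOn ℂ F' {z | ‖z‖ < min R R'} :=
    hF'.1.mono fun t (ht : ‖t‖ < _) => lt_of_lt_of_le ht (min_le_right _ _)
  have hpre : IsPreconnected {z : ℂ | ‖z‖ < min R R'} := by
    have := (convex_ball (0 : ℂ) (min R R')).isPreconnected
    convert this using 1
    ext t
    simp
  have hzz : ‖z‖ < min R R' := lt_min h h'
  refine (h1.analyticOnNhd hU).eqOn_of_preconnected_of_eventuallyEq (h2.analyticOnNhd hU)
    hpre (z₀ := 0) (by simpa using (norm_nonneg z).trans_lt hzz) ?_ hzz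
  filter_upwards [(isOpen_norm_lt 1).mem_nhds (show (0 : ℂ) ∈ {z : ℂ | ‖z‖ < 1} by simp)]
    with t ht
  rw [hF.2 t ht, hF'.2 t ht]

/-- The definition chooses a continuation depending on z; the identity theorem makes the choice
immaterial. -/
lemma szegoExt_eq {w : Circle → ℝ} {s : ℝ} {F : ℂ → ℂ} (hF : IsExteriorContinuation w s F)
    (hs : 0 < s) {z : ℂ} (hz : s < ‖z‖) : szegoExt w z = F z := by
  have h : ∃ F : ℂ → ℂ, ∃ s : ℝ, 0 < s ∧ s < ‖z‖ ∧ IsExteriorContinuation w s F :=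
    ⟨F, s, hs, hz, hF⟩
  rw [szegoExt, dif_pos h]
  obtain ⟨s', hs', hz', hF'⟩ := h.choose_spec
  exact eqOn_of_isExteriorContinuation hF' hF hs'.le hz' hz

lemma invSzegoInt_eq {w : Circle → ℝ} {R : ℝ} {F : ℂ → ℂ} (hF : IsInvInteriorContinuation w R F)
    (hR : 1 ≤ R) {z : ℂ} (hz : ‖z‖ < R) : invSzegoInt w z = F z := by
  have h : ∃ F : ℂ → ℂ, ∃ R : ℝ, 1 ≤ R ∧ ‖z‖ < R ∧ IsInvInteriorContinuation w R F :=
    ⟨F, R, hR, hz, hF⟩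
  rw [invSzegoInt, dif_pos h]
  obtain ⟨R', hR', hz', hF'⟩ := h.choose_spec
  exact eqOn_of_isInvInteriorContinuation hF' hF hz' hz

open ComplexConjugate in
lemma IsExteriorContinuation.reflect {w : Circle → ℝ} {s : ℝ} {F : ℂ → ℂ} (hs : 0 < s)
    (hF : IsExteriorContinuation w s F)
    (hd : DifferentiableOn ℂ (fun z => (szego w z)⁻¹) {z | ‖z‖ < 1}) :
    ∃ G, IsInvInteriorContinuation w (1 / s) G := by
  -- The reflected formula fails at 0, so the original function is used in the disc; the two agree
  -- for 0 < |z| < 1 by `szego_conj_inv`.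
  refine ⟨fun z => if ‖z‖ < 1 then (szego w z)⁻¹ else conj (F (conj z)⁻¹), fun z hz => ?_,
    fun z hz => if_pos hz⟩
  refine DifferentiableAt.differentiableWithinAt ?_
  rcases eq_or_ne z 0 with rfl | h0
  · refine (hd.differentiableAt ((isOpen_norm_lt 1).mem_nhds (by simp))).congr_of_eventuallyEq ?_
    filter_upwards [(isOpen_norm_lt 1).mem_nhds (show (0 : ℂ) ∈ {z : ℂ | ‖z‖ < 1} by simp)]
      with t ht
    exact if_pos ht
  · have hz' : ‖z‖ < 1 / s := hz
    have hmem : s < ‖(conj (conj z))⁻¹‖ := by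
      rw [Complex.conj_conj, norm_inv, lt_inv_comm₀ hs (norm_pos_iff.2 h0), ← one_div]
      exact hz'
    have h1 : DifferentiableAt ℂ (fun t => F t⁻¹) (conj z) := by
      refine DifferentiableAt.comp (conj z) (g := F) ?_ (differentiableAt_inv (by simpa using h0))
      refine hF.1.differentiableAt ((isOpen_norm_gt s).mem_nhds ?_)
      simpa using hmem
    have h2 := h1.conj_conj
    rw [Complex.conj_conj] at h2
    refine h2.congr_of_eventuallyEq ?_
    filter_upwards [isOpen_ne.mem_nhds h0] with t ht
    simp only [Function.comp_apply]
    split_ifs with h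
    · rw [hF.2, szego_conj_inv w ht h.ne]
      rw [norm_inv, Complex.norm_conj]
      exact (one_lt_inv₀ (norm_pos_iff.2 ht)).2 h
    · rfl

/-- The properties of the pair `D = D_e`, `V = 1 / D_i` on which the Riemann–Hilbert analysis
relies. -/
structure IsSzegoPair (w : Circle → ℝ) (s a b : ℝ) (D V : ℂ → ℂ) : Prop where
  s_pos : 0 < s
  s_lt : s < a
  lt_one : a < 1
  one_lt : 1 < b
  lt_inv : b < 1 / s
  differentiableOn_ext : DifferentiableOn ℂ D {z | s < ‖z‖}
  differentiableOn_int : DifferentiableOn ℂ V {z | ‖z‖ < 1 / s}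
  ext_ne_zero : ∀ z, a < ‖z‖ → D z ≠ 0
  int_ne_zero : ∀ z, ‖z‖ < b → V z ≠ 0
  weight_mul : ∀ z : Circle, (w z : ℂ) * (V z * D z) = 1
  tendsto_ext : Tendsto D (Bornology.cobounded ℂ) (𝓝 (tau w))
  int_zero : V 0 = tau w

lemma exists_isSzegoPair {w : Circle → ℝ} (hw : IsPositiveAnalyticWeight w) {r : ℝ}
    (hρr : criticalRadius w < r) (hr : r < 1) :
    ∃ s a b, s < r ∧ r < a ∧ b < 1 / r ∧ IsSzegoPair w s a b (szegoExt w) (invSzegoInt w) := by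
  obtain ⟨a₀, b₀, Qe, Qi, ha0, ha1, hb1, hQe, hQi, hDe, hDi, hQ, hlim⟩ :=
    exists_szego_continuation hw
  have hFe : IsExteriorContinuation w a₀ fun z => Complex.exp (Qe z) :=
    ⟨hQe.cexp, fun z hz => (hDe z hz).symm⟩
  have hFi : IsInvInteriorContinuation w b₀ fun z => Complex.exp (-Qi z) :=
    ⟨hQi.neg.cexp, fun z hz => by simp only [hDi z hz, Complex.exp_neg]⟩
  have hne : {s : ℝ | 0 < s ∧ s < 1 ∧ ∃ F : ℂ → ℂ, IsExteriorContinuation w s F}.Nonempty :=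
    ⟨a₀, ha0, ha1, _, hFe⟩
  obtain ⟨s, ⟨hs0, hs1, F, hF⟩, hsr⟩ := exists_lt_of_csInf_lt hne hρr
  have hr0 : 0 < r := hs0.trans hsr
  obtain ⟨G, hG⟩ := hF.reflect hs0 ((hFi.1.mono fun z hz =>
    lt_trans (show ‖z‖ < 1 from hz) hb1).congr fun z hz => (hFi.2 z hz).symm)
  have hs1' : 1 < 1 / s := by rwa [lt_one_div zero_lt_one hs0, one_div_one]
  have hr1' : 1 < 1 / r := by rwa [lt_one_div zero_lt_one hr0, one_div_one]
  have hrs : 1 / r < 1 / s := one_div_lt_one_div_of_lt hs0 hsr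
  -- The exponential form excludes zeros of D_e for |z| > a and of 1/D_i for |z| < b. With r < a and
  -- b < 1/r, no assumption is made on zeros of D_e at |z| = r or of 1/D_i at |z| = 1/r.
  obtain ⟨a, haa, ha1⟩ := exists_between (max_lt ha1 hr)
  obtain ⟨b, hb1', hbb⟩ := exists_between (lt_min hb1 hr1')
  have haa0 : a₀ < a := (le_max_left _ _).trans_lt haa
  have har : r < a := (le_max_right _ _).trans_lt haa
  have hbb0 : b < b₀ := hbb.trans_le (min_le_left _ _)
  have hbr : b < 1 / r := hbb.trans_le (min_le_right _ _)
  have hV : ∀ z, ‖z‖ < b₀ → invSzegoInt w z = Complex.exp (-Qi z) := fun z hz =>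
    invSzegoInt_eq hFi hb1.le hz
  have hD : ∀ z, a₀ < ‖z‖ → szegoExt w z = Complex.exp (Qe z) := fun z hz =>
    szegoExt_eq hFe ha0 hz
  refine ⟨s, a, b, hsr, har, hbr, hs0, hsr.trans har, ha1, hb1', hbr.trans hrs,
    hF.1.congr fun z hz => szegoExt_eq hF hs0 hz,
    hG.1.congr fun z hz => invSzegoInt_eq hG hs1'.le hz, fun z hz => ?_, fun z hz => ?_,
    fun z => ?_, hlim.congr' ?_, ?_⟩
  · rw [hD z (haa0.trans hz)]
    exact Complex.exp_ne_zero _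
  · rw [hV z (hz.trans hbb0)]
    exact Complex.exp_ne_zero _
  · rw [hV z (by rw [Circle.norm_coe]; linarith), hD z (by rw [Circle.norm_coe]; linarith),
      ← Complex.exp_add, neg_add_eq_sub, ← neg_sub, hQ, Complex.exp_neg, ← Complex.ofReal_exp,
      Real.exp_log (hw.pos z), mul_inv_cancel₀ (Complex.ofReal_ne_zero.2 (hw.pos z).ne')]
  · filter_upwards [tendsto_norm_cobounded_atTop.eventually_gt_atTop 1] with z hz
    rw [hDe z hz, hD z (by linarith)]
  · rw [hV 0 (by simp; linarith), Complex.exp_neg, ← hDi 0 (by simp), szego_zero, inv_inv]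

/-! ### The integral equations satisfied by a row of the transformed Riemann–Hilbert problem -/

/-- The density `P w t⁻ⁿ` with the weight written as `1 / (V D)`. -/
noncomputable def rowDensity (D V : ℂ → ℂ) (n : ℕ) (P : ℂ → ℂ) (t : ℂ) : ℂ :=
  P t / (t ^ n * (V t * D t))

/-- The kernel `-𝒮 tⁿ / τ²` of the operator on the circle of radius `r`. -/
noncomputable def intKernel (τ : ℂ) (D V : ℂ → ℂ) (n : ℕ) (t : ℂ) : ℂ :=
  -(D t * t ^ n / (τ ^ 2 * V t))

/-- The kernel `τ² / (𝒮 tⁿ)` of the operator on the circle of radius `1 / r`. -/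
noncomputable def extKernel (τ : ℂ) (D V : ℂ → ℂ) (n : ℕ) (t : ℂ) : ℂ :=
  τ ^ 2 * V t / (D t * t ^ n)

lemma DifferentiableOn.of_eqOn_cover {f g h : ℂ → ℂ} {U Ug Uh : Set ℂ} (hUg : IsOpen Ug)
    (hUh : IsOpen Uh) (hU : ∀ z ∈ U, z ∈ Ug ∨ z ∈ Uh) (hg : DifferentiableOn ℂ g Ug)
    (hh : DifferentiableOn ℂ h Uh) (hfg : ∀ z ∈ Ug, f z = g z) (hfh : ∀ z ∈ Uh, f z = h z) :
    DifferentiableOn ℂ f U := by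
  intro z hz
  refine DifferentiableAt.differentiableWithinAt ?_
  rcases hU z hz with hz | hz
  · refine (hg.differentiableAt (hUg.mem_nhds hz)).congr_of_eventuallyEq ?_
    filter_upwards [hUg.mem_nhds hz] with t ht using hfg t ht
  · refine (hh.differentiableAt (hUh.mem_nhds hz)).congr_of_eventuallyEq ?_
    filter_upwards [hUh.mem_nhds hz] with t ht using hfh t ht

lemma IsSzegoPair.differentiableOn_rowDensity {w : Circle → ℝ} {s a b : ℝ} {D V : ℂ → ℂ}
    (hp : IsSzegoPair w s a b D V) (n : ℕ) {P : ℂ → ℂ} (hP : Differentiable ℂ P) :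
    DifferentiableOn ℂ (rowDensity D V n P) (annulus a b) := by
  have h0 : 0 < a := hp.s_pos.trans hp.s_lt
  refine hP.differentiableOn.div ((by fun_prop : DifferentiableOn ℂ (fun z : ℂ => z ^ n) _).mul
    ((hp.differentiableOn_int.mono fun z hz => hz.2.trans hp.lt_inv).mul
      (hp.differentiableOn_ext.mono fun z hz => hp.s_lt.trans hz.1))) fun z hz => ?_
  exact mul_ne_zero (pow_ne_zero _ (norm_pos_iff.1 (h0.trans hz.1)))
    (mul_ne_zero (hp.int_ne_zero z hz.2) (hp.ext_ne_zero z hz.1))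

/-- T₁, T₂ form a row of YHKN⁻¹, described region by region so that it can be matched with the
matrix product. The last clause recovers P also on the unit circle, where the matrices are not used.
-/
lemma IsSzegoPair.exists_row {w : Circle → ℝ} {r s a b : ℝ} {D V : ℂ → ℂ}
    (hp : IsSzegoPair w s a b D V) (hsr : s < r) (hra : r < a) (hbr : b < 1 / r) (n : ℕ)
    {P : ℂ → ℂ} (hP : Differentiable ℂ P) {α β : ℂ}
    (hα : Tendsto (fun z => P z / z ^ n) (Bornology.cobounded ℂ) (𝓝 α))
    (hβ : Tendsto (fun z => z ^ n * cauchyTransform 1 (rowDensity D V n P) z)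
      (Bornology.cobounded ℂ) (𝓝 β)) :
    ∃ T₁ T₂ : ℂ → ℂ,
      DifferentiableOn ℂ T₁ {z | ‖z‖ < 1 / r} ∧ DifferentiableOn ℂ T₂ {z | r < ‖z‖} ∧
      (∀ z, ‖z‖ ≠ 1 / r →
        T₁ z = α + cauchyTransform (1 / r) (fun t => T₂ t * extKernel (tau w) D V n t) z) ∧
      (∀ z, ‖z‖ ≠ r →
        T₂ z = β + cauchyTransform r (fun t => T₁ t * intKernel (tau w) D V n t) z) ∧
      (∀ z, ‖z‖ < 1 → T₁ z = tau w * V z * cauchyTransform 1 (rowDensity D V n P) z) ∧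
      (∀ z, 1 < ‖z‖ → ‖z‖ < 1 / r → T₁ z = tau w * P z / (z ^ n * D z) +
        tau w * V z * cauchyTransform 1 (rowDensity D V n P) z) ∧
      (∀ z, 1 / r < ‖z‖ → T₁ z = tau w * P z / (z ^ n * D z)) ∧
      (∀ z, ‖z‖ < r → T₂ z = -(P z / (tau w * V z))) ∧
      (∀ z, r < ‖z‖ → ‖z‖ < 1 →
        T₂ z = z ^ n * D z * cauchyTransform 1 (rowDensity D V n P) z / tau w -
          P z / (tau w * V z)) ∧
      (∀ z, 1 < ‖z‖ →
        T₂ z = z ^ n * D z * cauchyTransform 1 (rowDensity D V n P) z / tau w) ∧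
      (∀ z, r < ‖z‖ → ‖z‖ < 1 / r →
        P z = (tau w : ℂ)⁻¹ * z ^ n * D z * T₁ z - tau w * V z * T₂ z) := by
  have hr0 : 0 < r := hp.s_pos.trans hsr
  have ha0 : 0 < a := hr0.trans hra
  have hτ := tau_ne_zero w
  have hA := hp.differentiableOn_rowDensity n hP
  set A := rowDensity D V n P with hAdef
  obtain ⟨a', haa', ha'1⟩ := exists_between hp.lt_one
  obtain ⟨b', hb'1, hb'b⟩ := exists_between hp.one_lt
  have ha'0 : 0 < a' := ha0.trans haa'
  have hrs : 1 / r < 1 / s := one_div_lt_one_div_of_lt hp.s_pos hsr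
  have hsphA : ∀ c, a < c → c < b → ContinuousOn A (Metric.sphere 0 c) := fun c h1 h2 =>
    hA.continuousOn.mono (sphere_subset_annulus h1 h2)
  -- Yi and Ye continue the Cauchy integral over the unit circle from inside and from outside; on
  -- the overlap a' < |z| < b' they differ by A.
  set Yi := cauchyTransform b' A with hYi
  set Ye := cauchyTransform a' A with hYe
  have hYid : DifferentiableOn ℂ Yi {z | ‖z‖ < b'} :=
    (differentiableOn_cauchyTransform (by linarith) (hsphA _ (by linarith) hb'b)).mono
      fun z hz => ne_of_lt hz
  have hYed : DifferentiableOn ℂ Ye {z | a' < ‖z‖} :=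
    (differentiableOn_cauchyTransform ha'0.le (hsphA _ haa' (by linarith))).mono
      fun z hz => ne_of_gt hz
  have hjump : ∀ z, a' < ‖z‖ → ‖z‖ < b' → Yi z - Ye z = A z := fun z h1 h2 =>
    cauchyTransform_jump ha0.le hA haa' hb'b h1 h2
  have hYin : ∀ z, ‖z‖ < 1 → cauchyTransform 1 A z = Yi z := fun z hz =>
    cauchyTransform_shift ha0.le hA (by linarith) (by linarith) (by linarith) hb'b
      (Or.inl ⟨hz, by linarith⟩)
  have hYout : ∀ z, 1 < ‖z‖ → cauchyTransform 1 A z = Ye z := fun z hz =>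
    cauchyTransform_shift ha0.le hA (by linarith) (by linarith) haa' (by linarith)
      (Or.inr ⟨hz, by linarith⟩)
  have hz0 : ∀ z : ℂ, a < ‖z‖ → z ^ n ≠ 0 := fun z hz =>
    pow_ne_zero _ (norm_pos_iff.1 (ha0.trans hz))
  set T1e : ℂ → ℂ := fun z => tau w * P z / (z ^ n * D z) with hT1e
  set T2i : ℂ → ℂ := fun z => -(P z / (tau w * V z)) with hT2i
  -- The suffixes e, i mark exterior and interior pieces. T1i and T2e have to be glued across the
  -- unit circle; the two formulas agree on the overlap because Yi - Ye = A.
  set T1i : ℂ → ℂ := fun z => if ‖z‖ < b' then tau w * V z * Yi z else T1e z + tau w * V z * Ye z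
    with hT1i
  set T2e : ℂ → ℂ := fun z => if a' < ‖z‖ then z ^ n * D z * Ye z / tau w
    else z ^ n * D z * Yi z / tau w + T2i z with hT2e
  have hT1i1 : ∀ z, ‖z‖ < b' → T1i z = tau w * V z * Yi z := fun z hz => if_pos hz
  have hT1i2 : ∀ z, a' < ‖z‖ → T1i z = T1e z + tau w * V z * Ye z := by
    intro z hz
    by_cases h : ‖z‖ < b'
    · rw [hT1i1 z h, eq_add_of_sub_eq (hjump z hz h)]
      have h1 := hz0 z (haa'.trans hz)
      have h2 := hp.ext_ne_zero z (haa'.trans hz)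
      have h3 := hp.int_ne_zero z (h.trans hb'b)
      simp only [hT1e, hAdef, rowDensity]
      field_simp
    · exact if_neg h
  have hT2e1 : ∀ z, a' < ‖z‖ → T2e z = z ^ n * D z * Ye z / tau w := fun z hz => if_pos hz
  have hT2e2 : ∀ z, ‖z‖ < b' → T2e z = z ^ n * D z * Yi z / tau w + T2i z := by
    intro z hz
    by_cases h : a' < ‖z‖
    · rw [hT2e1 z h, eq_add_of_sub_eq (hjump z h hz)]
      have h1 := hz0 z (haa'.trans h)
      have h2 := hp.ext_ne_zero z (haa'.trans h)
      have h3 := hp.int_ne_zero z (hz.trans hb'b)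
      simp only [hT2i, hAdef, rowDensity]
      field_simp
      ring
    · exact if_neg h
  have hpow : ∀ U, DifferentiableOn ℂ (fun z : ℂ => z ^ n) U := fun U => by fun_prop
  have hDd : ∀ U, (∀ z ∈ U, s < ‖z‖) → DifferentiableOn ℂ D U := fun U hU =>
    hp.differentiableOn_ext.mono hU
  have hVd : ∀ U, (∀ z ∈ U, ‖z‖ < 1 / s) → DifferentiableOn ℂ V U := fun U hU =>
    hp.differentiableOn_int.mono hU
  have hsa := hp.s_lt
  have hb's : b' < 1 / s := hb'b.trans hp.lt_inv
  have hT1ed : DifferentiableOn ℂ T1e {z | a < ‖z‖} :=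
    (hP.differentiableOn.const_mul _).div ((hpow _).mul (hDd _ fun z hz => hsa.trans hz))
      fun z hz => mul_ne_zero (hz0 z hz) (hp.ext_ne_zero z hz)
  have hT2id : DifferentiableOn ℂ T2i {z | ‖z‖ < b} :=
    (hP.differentiableOn.div ((hVd _ fun z hz => lt_trans hz hp.lt_inv).const_mul _)
      fun z hz => mul_ne_zero hτ (hp.int_ne_zero z hz)).neg
  -- T1i is holomorphic beyond the circle 1/r, and T2e below to inside the circle r, so Cauchy's
  -- formula applies on the contours themselves.
  have hT1id : DifferentiableOn ℂ T1i {z | ‖z‖ < 1 / s} := by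
    refine DifferentiableOn.of_eqOn_cover (isOpen_norm_lt b') (isOpen_annulus a' (1 / s))
      (g := fun z => tau w * V z * Yi z) (h := fun z => T1e z + tau w * V z * Ye z) ?_ ?_ ?_
      hT1i1 fun z hz => hT1i2 z hz.1
    · intro z hz
      by_cases h : ‖z‖ < b'
      · exact Or.inl h
      · exact Or.inr ⟨by linarith, hz⟩
    · exact ((hVd _ fun z hz => lt_trans hz hb's).const_mul _).mul hYid
    · exact (hT1ed.mono fun z hz => haa'.trans hz.1).add
        (((hVd _ fun z hz => hz.2).const_mul _).mul (hYed.mono fun z hz => hz.1))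
  have hT2ed : DifferentiableOn ℂ T2e {z | s < ‖z‖} := by
    refine DifferentiableOn.of_eqOn_cover (isOpen_norm_gt a') (isOpen_annulus s b')
      (g := fun z => z ^ n * D z * Ye z / tau w)
      (h := fun z => z ^ n * D z * Yi z / tau w + T2i z) ?_ ?_ ?_
      hT2e1 fun z hz => hT2e2 z hz.2
    · intro z hz
      by_cases h : a' < ‖z‖
      · exact Or.inl h
      · exact Or.inr ⟨hz, by linarith⟩
    · exact (((hpow _).mul (hDd _ fun z hz => (hsa.trans haa').trans hz)).mul hYed).div_const _
    · exact ((((hpow _).mul (hDd _ fun z hz => hz.1)).mul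
        (hYid.mono fun z hz => hz.2)).div_const _).add (hT2id.mono fun z hz => hz.2.trans hb'b)
  have hT1e_lim : Tendsto T1e (Bornology.cobounded ℂ) (𝓝 α) := by
    have h := (hα.const_mul (tau w : ℂ)).div hp.tendsto_ext hτ
    rw [mul_div_cancel_left₀ _ hτ] at h
    refine h.congr fun z => ?_
    simp only [hT1e, Pi.div_apply]
    rw [← mul_div_assoc, div_div]
  have hT2e_lim : Tendsto T2e (Bornology.cobounded ℂ) (𝓝 β) := by
    have h := (hβ.mul hp.tendsto_ext).div_const (tau w : ℂ)
    rw [mul_div_cancel_right₀ _ hτ] at h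
    refine h.congr' ?_
    filter_upwards [tendsto_norm_cobounded_atTop.eventually_gt_atTop 1] with z hz
    rw [hT2e1 z (by linarith), hYout z hz]
    ring
  have hb'r : b' < 1 / r := hb'b.trans hbr
  have hra' : r < a' := hra.trans haa'
  set T₁ : ℂ → ℂ := fun z => if ‖z‖ < 1 / r then T1i z else T1e z with hT₁
  set T₂ : ℂ → ℂ := fun z => if r < ‖z‖ then T2e z else T2i z with hT₂
  have hT₁i : ∀ z, ‖z‖ < 1 / r → T₁ z = T1i z := fun z hz => if_pos hz
  have hT₁e : ∀ z, 1 / r < ‖z‖ → T₁ z = T1e z := fun z hz => if_neg hz.not_gt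
  have hT₂e : ∀ z, r < ‖z‖ → T₂ z = T2e z := fun z hz => if_pos hz
  have hT₂i : ∀ z, ‖z‖ < r → T₂ z = T2i z := fun z hz => if_neg hz.not_gt
  have hsph : ∀ {f : ℂ → ℂ} {U : Set ℂ} {c : ℝ}, DifferentiableOn ℂ f U →
      (∀ z : ℂ, ‖z‖ = c → z ∈ U) → ContinuousOn f (Metric.sphere 0 c) := fun hf hU =>
    hf.continuousOn.mono fun z hz => hU z (by simpa using hz)
  have hr0' : 0 < 1 / r := one_div_pos.2 hr0
  refine ⟨T₁, T₂, ?_, ?_, ?_, ?_, ?_, ?_, ?_, ?_, ?_, ?_, ?_⟩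
  · exact (hT1id.mono fun z hz => lt_trans hz hrs).congr hT₁i
  · exact (hT2ed.mono fun z hz => hsr.trans hz).congr hT₂e
  · intro z hz
    -- On |t| = 1/r the density is T1i - T1e. The transform of T1i is T1i inside and 0 outside; that
    -- of T1e is α inside and α - T1e outside. The second equation is proved in the same way on |t|
    -- = r.
    rw [cauchyTransform_congr hr0'.le (h' := fun t => T1i t - T1e t), cauchyTransform_sub hr0'.le
      (hsph hT1id fun t ht => ht.trans_lt hrs)
      (hsph hT1ed fun t ht => (by linarith : a < 1 / r).trans_eq ht.symm) hz]
    · rcases hz.lt_or_gt with hz | hz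
      · rw [cauchyTransform_eq_of_lt hT1id hrs hz,
          cauchyTransform_exterior_of_lt ha0.le (by linarith) hT1ed hT1e_lim hz, hT₁i z hz]
        ring
      · rw [cauchyTransform_eq_zero_of_gt hr0'.le hT1id hrs hz,
          cauchyTransform_exterior_of_gt ha0.le (by linarith) hT1ed hT1e_lim hz, hT₁e z hz]
        ring
    · intro t ht
      have h1 := hz0 t (by linarith)
      have h2 := hp.ext_ne_zero t (by linarith)
      rw [hT₂e t (by linarith), hT2e1 t (by linarith), hT1i2 t (by linarith), extKernel]
      field_simp
      ring
  · intro z hz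
    rw [cauchyTransform_congr hr0.le (h' := fun t => T2i t - T2e t), cauchyTransform_sub hr0.le
      (hsph hT2id fun t ht => ht.trans_lt (by linarith))
      (hsph hT2ed fun t ht => hsr.trans_eq ht.symm) hz]
    · rcases hz.lt_or_gt with hz | hz
      · rw [cauchyTransform_eq_of_lt hT2id (by linarith) hz,
          cauchyTransform_exterior_of_lt hp.s_pos.le hsr hT2ed hT2e_lim hz, hT₂i z hz]
        ring
      · rw [cauchyTransform_eq_zero_of_gt hr0.le hT2id (by linarith) hz,
          cauchyTransform_exterior_of_gt hp.s_pos.le hsr hT2ed hT2e_lim hz, hT₂e z hz]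
        ring
    · intro t ht
      have h3 := hp.int_ne_zero t (by linarith)
      rw [hT₁i t (by linarith), hT1i1 t (by linarith), hT2e2 t (by linarith), intKernel]
      field_simp
      ring
  · intro z hz
    rw [hT₁i z (by linarith), hT1i1 z (by linarith), hYin z hz]
  · intro z hz hz'
    rw [hT₁i z hz', hT1i2 z (by linarith), hYout z hz]
  · exact hT₁e
  · exact hT₂i
  · intro z hz hz'
    rw [hT₂e z hz, hT2e2 z (by linarith), hYin z hz', hT2i, sub_eq_add_neg]
  · intro z hz
    rw [hT₂e z (by linarith), hT2e1 z (by linarith), hYout z hz]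
  · intro z hz hz'
    rw [hT₁i z hz', hT₂e z hz]
    by_cases h : ‖z‖ < b'
    · have h3 := hp.int_ne_zero z (by linarith)
      rw [hT1i1 z h, hT2e2 z h]
      simp only [hT2i]
      field_simp
      ring
    · have h1 := hz0 z (by linarith)
      have h2 := hp.ext_ne_zero z (by linarith)
      rw [hT1i2 z (by linarith), hT2e1 z (by linarith)]
      simp only [hT1e]
      field_simp
      ring

/-! ### Neumann series of a pair of contractions -/

/-- `I` maps functions holomorphic on `U` to functions holomorphic on `U'`, additively, and halves
the supremum over `A ⊆ U`, the image being measured on `B'`; its value depends on `A` only. -/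
structure IsHalving (I : (ℂ → ℂ) → ℂ → ℂ) (U A U' B' : Set ℂ) : Prop where
  differentiableOn : ∀ f, DifferentiableOn ℂ f U → DifferentiableOn ℂ (I f) U'
  norm_le : ∀ f M, DifferentiableOn ℂ f U → (∀ z ∈ A, ‖f z‖ ≤ M) → ∀ z ∈ B', ‖I f z‖ ≤ M / 2
  sub : ∀ f g, DifferentiableOn ℂ f U → DifferentiableOn ℂ g U → ∀ z ∈ B',
    I (fun t => f t - g t) z = I f z - I g z
  congr : ∀ f g, (∀ z ∈ A, f z = g z) → I f = I g

/-- A solution (T₁, T₂) being given, substituting the equations into each other expresses each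
remainder through the preceding one, and a round trip through I and E divides it by 4. -/
lemma neumann_hasSum {I E : (ℂ → ℂ) → ℂ → ℂ} {U A B U' A' B' : Set ℂ}
    (hI : IsHalving I U A U' B') (hE : IsHalving E U' A' U B) (hAB : A ⊆ B) (hAB' : A' ⊆ B')
    {u : ℕ → ℂ → ℂ} (hu0 : DifferentiableOn ℂ (u 0) U) {M : ℝ} (hM : ∀ z ∈ B, ‖u 0 z‖ ≤ M)
    (hodd : ∀ k, u (2 * k + 1) = I (u (2 * k))) (heven : ∀ k, u (2 * k + 2) = E (u (2 * k + 1)))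
    {T₁ T₂ : ℂ → ℂ} (hT₁ : DifferentiableOn ℂ T₁ U) (hT₂ : DifferentiableOn ℂ T₂ U')
    {M' : ℝ} (hM' : ∀ z ∈ A, ‖T₁ z‖ ≤ M') (h₁ : ∀ z ∈ B, T₁ z = u 0 z + E T₂ z)
    (h₂ : ∀ z ∈ B', T₂ z = I T₁ z) :
    (∀ k, ∀ z ∈ B, ‖u (2 * k) z‖ ≤ M * (1 / 4) ^ k) ∧
      (∀ k, ∀ z ∈ B', ‖u (2 * k + 1) z‖ ≤ M * (1 / 4) ^ k) ∧
      (∀ z ∈ B, HasSum (fun k => u (2 * k) z) (T₁ z)) ∧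
      ∀ z ∈ B', HasSum (fun k => u (2 * k + 1) z) (T₂ z) := by
  have hu : ∀ k, DifferentiableOn ℂ (u (2 * k)) U ∧ ∀ z ∈ B, ‖u (2 * k) z‖ ≤ M * (1 / 4) ^ k := by
    intro k
    induction k with
    | zero => exact ⟨hu0, fun z hz => by simpa using hM z hz⟩
    | succ k ih =>
      have hd := hI.differentiableOn _ ih.1
      have hn := hI.norm_le _ _ ih.1 fun z hz => ih.2 z (hAB hz)
      rw [show 2 * (k + 1) = 2 * k + 2 by ring, heven, hodd]
      refine ⟨hE.differentiableOn _ hd, fun z hz => ?_⟩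
      refine (hE.norm_le _ _ hd (fun z hz => hn z (hAB' hz)) z hz).trans_eq ?_
      ring
  have hu' : ∀ k, ∀ z ∈ B', ‖u (2 * k + 1) z‖ ≤ M * (1 / 4) ^ k / 2 := fun k => by
    rw [hodd]
    exact hI.norm_le _ _ (hu k).1 fun z hz => (hu k).2 z (hAB hz)
  have hM0 : ∀ z ∈ B', ∀ k, M * (1 / 4) ^ k / 2 ≤ M * (1 / 4 : ℝ) ^ k := fun z hz k => by
    have := (norm_nonneg _).trans (hu' k z hz)
    linarith
  have hudiff : ∀ k, DifferentiableOn ℂ (u (2 * k + 1)) U' := fun k => by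
    rw [hodd]; exact hI.differentiableOn _ (hu k).1
  have hS : ∀ N, DifferentiableOn ℂ (fun z => ∑ k ∈ Finset.range N, u (2 * k) z) U := fun N =>
    DifferentiableOn.fun_sum fun k _ => (hu k).1
  have hS' : ∀ N, DifferentiableOn ℂ (fun z => ∑ k ∈ Finset.range N, u (2 * k + 1) z) U' :=
    fun N => DifferentiableOn.fun_sum fun k _ => hudiff k
  have hzeroI : ∀ z ∈ B', I (fun _ => 0) z = 0 := fun z hz => by
    have := hI.sub (fun _ => 0) (fun _ => 0) (differentiableOn_const _) (differentiableOn_const _)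
      z hz
    simpa using this
  have hzeroE : ∀ z ∈ B, E (fun _ => 0) z = 0 := fun z hz => by
    have := hE.sub (fun _ => 0) (fun _ => 0) (differentiableOn_const _) (differentiableOn_const _)
      z hz
    simpa using this
  -- Additivity, recovered from compatibility with differences.
  have hneg : ∀ {J : (ℂ → ℂ) → ℂ → ℂ} {X Y X' Y' : Set ℂ}, IsHalving J X Y X' Y' →
      ∀ f g, DifferentiableOn ℂ f X → DifferentiableOn ℂ g X → ∀ z ∈ Y',
      J (fun t => f t + g t) z = J f z + J g z := by
    intro J X Y X' Y' hJ f g hf hg z hz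
    have := hJ.sub (fun t => f t + g t) g (hf.add hg) hg z hz
    simp only [add_sub_cancel_right] at this
    rw [this, sub_add_cancel]
  have hIS : ∀ N, ∀ z ∈ B', I (fun z => ∑ k ∈ Finset.range N, u (2 * k) z) z =
      ∑ k ∈ Finset.range N, u (2 * k + 1) z := by
    intro N z hz
    induction N with
    | zero => simpa using hzeroI z hz
    | succ N ih =>
      simp only [Finset.sum_range_succ]
      rw [hneg hI _ _ (hS N) (hu N).1 z hz, ih, hodd]
  have hES : ∀ N, ∀ z ∈ B, E (fun z => ∑ k ∈ Finset.range N, u (2 * k + 1) z) z =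
      ∑ k ∈ Finset.range N, u (2 * k + 2) z := by
    intro N z hz
    induction N with
    | zero => simpa using hzeroE z hz
    | succ N ih =>
      simp only [Finset.sum_range_succ]
      rw [hneg hE _ _ (hS' N) (hudiff N) z hz, ih, heven]
  have hremI : ∀ N, ∀ z ∈ B', T₂ z - ∑ k ∈ Finset.range N, u (2 * k + 1) z =
      I (fun t => T₁ t - ∑ k ∈ Finset.range N, u (2 * k) t) z := fun N z hz => by
    rw [hI.sub _ _ hT₁ (hS N) z hz, ← h₂ z hz, hIS N z hz]
  -- The term `u 0` shifts the index: N terms removed from T₂ correspond to N + 1 terms removed from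
  -- T₁.
  have hremE : ∀ N, ∀ z ∈ B, T₁ z - ∑ k ∈ Finset.range (N + 1), u (2 * k) z =
      E (fun t => T₂ t - ∑ k ∈ Finset.range N, u (2 * k + 1) t) z := fun N z hz => by
    rw [hE.sub _ _ hT₂ (hS' N) z hz, hES N z hz, h₁ z hz, Finset.sum_range_succ']
    simp only [mul_add, mul_one, mul_zero]
    ring
  have hbound : ∀ N, (∀ z ∈ A, ‖T₁ z - ∑ k ∈ Finset.range N, u (2 * k) z‖ ≤ M' * (1 / 4) ^ N) ∧
      (∀ z ∈ B', ‖T₂ z - ∑ k ∈ Finset.range N, u (2 * k + 1) z‖ ≤ M' * (1 / 4) ^ N / 2) ∧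
      (∀ z ∈ B, ‖T₁ z - ∑ k ∈ Finset.range (N + 1), u (2 * k) z‖ ≤ M' * (1 / 4) ^ (N + 1)) := by
    have step : ∀ N, (∀ z ∈ A, ‖T₁ z - ∑ k ∈ Finset.range N, u (2 * k) z‖ ≤ M' * (1 / 4) ^ N) →
        (∀ z ∈ B', ‖T₂ z - ∑ k ∈ Finset.range N, u (2 * k + 1) z‖ ≤ M' * (1 / 4) ^ N / 2) ∧
        (∀ z ∈ B, ‖T₁ z - ∑ k ∈ Finset.range (N + 1), u (2 * k) z‖ ≤
          M' * (1 / 4) ^ (N + 1)) := by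
      intro N hN
      have h : ∀ z ∈ B', ‖T₂ z - ∑ k ∈ Finset.range N, u (2 * k + 1) z‖ ≤
          M' * (1 / 4) ^ N / 2 := fun z hz => by
        rw [hremI N z hz]
        exact hI.norm_le _ _ (hT₁.sub (hS N)) hN z hz
      refine ⟨h, fun z hz => ?_⟩
      rw [hremE N z hz]
      refine (hE.norm_le _ _ (hT₂.sub (hS' N)) (fun z hz => h z (hAB' hz)) z hz).trans_eq ?_
      ring
    intro N
    induction N with
    | zero =>
      have h0 : ∀ z ∈ A, ‖T₁ z - ∑ k ∈ Finset.range 0, u (2 * k) z‖ ≤ M' * (1 / 4) ^ 0 :=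
        fun z hz => by simpa using hM' z hz
      exact ⟨h0, step 0 h0⟩
    | succ N ih =>
      have h1 := fun z hz => ih.2.2 z (hAB hz)
      exact ⟨h1, step _ h1⟩
  have hgeo : Summable fun k : ℕ => M * (1 / 4 : ℝ) ^ k :=
    (summable_geometric_of_lt_one (by norm_num) (by norm_num)).mul_left M
  have hgeo0 : Tendsto (fun k : ℕ => M' * (1 / 4 : ℝ) ^ k) atTop (𝓝 0) := by
    simpa using (tendsto_pow_atTop_nhds_zero_of_lt_one (r := (1 / 4 : ℝ)) (by norm_num)
      (by norm_num)).const_mul M'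
  have hsum : ∀ {f : ℕ → ℂ} {S : ℂ}, Summable f →
      Tendsto (fun N => S - ∑ k ∈ Finset.range N, f k) atTop (𝓝 0) → HasSum f S := by
    intro f S hf hlim
    refine hf.hasSum_iff_tendsto_nat.2 ?_
    simpa using (hlim.const_sub S)
  refine ⟨fun k => (hu k).2, fun k z hz => (hu' k z hz).trans (hM0 z hz k), fun z hz => ?_,
    fun z hz => ?_⟩
  · refine hsum (Summable.of_norm_bounded hgeo fun k => (hu k).2 z hz) ?_
    -- T₁ is assumed bounded on A only, so on B the remainder is controlled from the first partial
    -- sum on.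
    refine (tendsto_add_atTop_iff_nat 1).1 ?_
    exact squeeze_zero_norm (fun N => (hbound N).2.2 z hz)
      ((tendsto_add_atTop_iff_nat 1).2 hgeo0)
  · refine hsum (Summable.of_norm_bounded hgeo fun k => (hu' k z hz).trans (hM0 z hz k)) ?_
    refine squeeze_zero_norm (fun N => (hbound N).2.1 z hz) ?_
    simpa using hgeo0.div_const 2

lemma convergesAbsUniformlyOn_of_geometric {u : ℕ → ℂ → ℂ} {B : Set ℂ} {M : ℝ}
    (h : ∀ k, ∀ z ∈ B, ‖u k z‖ ≤ M * (1 / 4) ^ k) : ConvergesAbsUniformlyOn u B := by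
  have hgeo : Summable fun k : ℕ => M * (1 / 4 : ℝ) ^ k :=
    (summable_geometric_of_lt_one (by norm_num) (by norm_num)).mul_left M
  exact ⟨fun z hz => Summable.of_nonneg_of_le (fun _ => norm_nonneg _) (fun k => h k z hz) hgeo,
    tendstoUniformlyOn_tsum_nat hgeo h⟩

/-! ### Cauchy operators as halving maps -/

/-- The closed annulus `α ≤ |z| ≤ β`. -/
def closedAnnulus (α β : ℝ) : Set ℂ := {z | α ≤ ‖z‖ ∧ ‖z‖ ≤ β}

lemma isCompact_closedAnnulus (α β : ℝ) : IsCompact (closedAnnulus α β) := by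
  refine (isCompact_closedBall (0 : ℂ) β).of_isClosed_subset ?_ fun z hz => by simpa using hz.2
  exact (isClosed_le continuous_const continuous_norm).inter
    (isClosed_le continuous_norm continuous_const)

/-- An integral operator over the circle of radius `c` whose kernel is small on a neighbouring
annulus is halving. -/
lemma isHalving_cauchyTransform {α β c₁ c c₂ d κ : ℝ} {k : ℂ → ℂ} {U' : Set ℂ} (hα : 0 ≤ α)
    (hd : 0 < d) (h1 : α < c₁) (h2 : c₂ < β) (hd1 : c₁ + d ≤ c) (hd2 : c + d ≤ c₂)
    (hk : DifferentiableOn ℂ k (annulus α β)) (hkκ : ∀ t ∈ closedAnnulus c₁ c₂, ‖k t‖ ≤ κ)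
    (hκ : c₂ / d * κ ≤ 1 / 2) (hU' : ∀ z ∈ U', ‖z‖ ≠ c) :
    IsHalving (fun f => cauchyTransform c fun t => f t * k t) (annulus α β) (closedAnnulus c₁ c₂)
      U' {z | ‖z‖ ≠ c} := by
  have hc0 : 0 ≤ c := by linarith
  have hsph : Metric.sphere (0 : ℂ) c ⊆ annulus α β :=
    sphere_subset_annulus (by linarith) (by linarith)
  have hc : ∀ f, DifferentiableOn ℂ f (annulus α β) →
      ContinuousOn (fun t => f t * k t) (Metric.sphere 0 c) := fun f hf =>
    ((hf.mul hk).continuousOn).mono hsph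
  have hck : (c : ℂ) ∈ closedAnnulus c₁ c₂ := by
    constructor <;> rw [Complex.norm_real, Real.norm_of_nonneg hc0] <;> linarith
  refine ⟨fun f hf => (differentiableOn_cauchyTransform hc0 (hc f hf)).mono hU', ?_, ?_, ?_⟩
  · intro f M hf hM z hz
    have hM0 : 0 ≤ M := (norm_nonneg _).trans (hM _ hck)
    refine (norm_cauchyTransform_le_of_annulus hα hd (hf.mul hk) h1 h2 hd1 hd2 (M := M * κ)
      (fun t ht ht' => ?_) hz).trans ?_
    · rw [Pi.mul_apply, norm_mul]
      exact mul_le_mul (hM t ⟨ht, ht'⟩) (hkκ t ⟨ht, ht'⟩) (norm_nonneg _) hM0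
    · calc c₂ / d * (M * κ) = M * (c₂ / d * κ) := by ring
        _ ≤ M * (1 / 2) := mul_le_mul_of_nonneg_left hκ hM0
        _ = M / 2 := by ring
  · intro f g hf hg z hz
    rw [← cauchyTransform_sub hc0 (hc f hf) (hc g hg) hz]
    simp only [sub_mul]
  · intro f g hfg
    ext z
    refine cauchyTransform_congr hc0 (fun t ht => ?_) z
    rw [hfg t ⟨by linarith, by linarith⟩]

/-! ### Identification of the iterates -/

lemma exteriorValue_eq {c : ℝ} (hc : 0 < c) {f : ℂ → ℂ} {t : ℂ} (ht : ‖t‖ = c)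
    (hf : ContinuousAt f t) : exteriorValue c f t = f t := by
  have hne : (𝓝[{z : ℂ | c < ‖z‖}] t).NeBot := by
    rw [← mem_closure_iff_nhdsWithin_neBot, Metric.mem_closure_iff]
    intro ε hε
    -- A radial push of t by ε/2. The approach filter must be nontrivial for the limit to be unique.
    refine ⟨((1 + ε / (2 * c) : ℝ) : ℂ) * t, ?_, ?_⟩
    · have hpos : 0 < ε / (2 * c) := by positivity
      rw [Set.mem_ofPred_eq, norm_mul, Complex.norm_real, Real.norm_of_nonneg (by positivity), ht]
      nlinarith
    · have : t - ((1 + ε / (2 * c) : ℝ) : ℂ) * t = ((-(ε / (2 * c)) : ℝ) : ℂ) * t := by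
        push_cast; ring
      rw [dist_eq_norm, this, norm_mul, Complex.norm_real, norm_neg,
        Real.norm_of_nonneg (by positivity), ht]
      have : ε / (2 * c) * c = ε / 2 := by field_simp
      linarith
  exact (hf.tendsto.mono_left nhdsWithin_le_nhds).limUnder_eq

lemma cauchyInt_eq (w : Circle → ℝ) {r : ℝ} (hr : 0 < r) (n : ℕ) {f : ℂ → ℂ}
    (hf : ∀ t, ‖t‖ = r → ContinuousAt f t) : cauchyInt w r n f =
      cauchyTransform r fun t => f t * intKernel (tau w) (szegoExt w) (invSzegoInt w) n t := by
  ext z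
  rw [cauchyInt, cauchyTransform, ← circleIntegral.integral_const_mul,
    ← circleIntegral.integral_const_mul]
  refine circleIntegral.integral_congr hr.le fun t ht => ?_
  have ht' : ‖t‖ = r := by simpa using ht
  simp only [exteriorValue_eq hr ht' (hf t ht'), scattering, szegoInt, intKernel, div_eq_mul_inv,
    mul_inv]
  ring

/-- At a zero of 1/D_i the conventional value of `szegoInt` is 0, but only 1/𝒮 enters here, and
inverting twice restores the correct value 0. -/
lemma cauchyExt_eq (w : Circle → ℝ) {r : ℝ} (hr : 0 < r) (n : ℕ) {f : ℂ → ℂ}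
    (hf : ∀ t, ‖t‖ = 1 / r → ContinuousAt f t) : cauchyExt w r n f =
      cauchyTransform (1 / r) fun t =>
        f t * extKernel (tau w) (szegoExt w) (invSzegoInt w) n t := by
  ext z
  have hr' : 0 < 1 / r := one_div_pos.2 hr
  rw [cauchyExt, cauchyTransform, ← circleIntegral.integral_const_mul,
    ← circleIntegral.integral_const_mul]
  refine circleIntegral.integral_congr hr'.le fun t ht => ?_
  have ht' : ‖t‖ = 1 / r := by simpa using ht
  simp only [exteriorValue_eq hr' ht' (hf t ht')]
  simp only [scattering, szegoInt, extKernel, div_eq_mul_inv,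
    mul_inv, inv_inv]
  ring

/-! ### Smallness of the kernels for large n -/

lemma exists_norm_mul_pow_le {K : Set ℂ} (hK : IsCompact K) {h p : ℂ → ℂ} (hh : ContinuousOn h K)
    {q : ℝ} (hq : q < 1) (hq0 : 0 ≤ q) (hp : ∀ z ∈ K, ‖p z‖ ≤ q) {ε : ℝ} (hε : 0 < ε) :
    ∃ n₀ : ℕ, ∀ n, n₀ ≤ n → ∀ z ∈ K, ‖h z * p z ^ n‖ ≤ ε := by
  obtain ⟨C, hC⟩ := hK.exists_bound_of_continuousOn hh
  have hlim : Tendsto (fun n : ℕ => C * q ^ n) atTop (𝓝 0) := by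
    simpa using (tendsto_pow_atTop_nhds_zero_of_lt_one hq0 hq).const_mul C
  obtain ⟨n₀, hn₀⟩ := eventually_atTop.1 (hlim.eventually_le_const hε)
  refine ⟨n₀, fun n hn z hz => le_trans ?_ (hn₀ n hn)⟩
  rw [norm_mul, norm_pow]
  exact mul_le_mul (hC z hz) (pow_le_pow_left₀ (norm_nonneg _) (hp z hz) n) (by positivity)
    ((norm_nonneg _).trans (hC z hz))

lemma IsSzegoPair.exists_isHalving {w : Circle → ℝ} {r s a b : ℝ} {D V : ℂ → ℂ}
    (hp : IsSzegoPair w s a b D V) (hsr : s < r) (hra : r < a) (hbr : b < 1 / r) :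
    ∃ A A' : Set ℂ, IsCompact A ∧ IsCompact A' ∧ A ⊆ annulus s 1 ∧ A' ⊆ annulus 1 (1 / s) ∧
      ∃ n₀ : ℕ, ∀ n, n₀ ≤ n →
        IsHalving (fun f => cauchyTransform r fun t => f t * intKernel (tau w) D V n t)
          (annulus s 1) A (annulus 1 (1 / s)) {z | ‖z‖ ≠ r} ∧
        IsHalving (fun f => cauchyTransform (1 / r) fun t => f t * extKernel (tau w) D V n t)
          (annulus 1 (1 / s)) A' (annulus s 1) {z | ‖z‖ ≠ 1 / r} := by
  have hr0 : 0 < r := hp.s_pos.trans hsr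
  have ha1 := hp.lt_one
  have hb1 := hp.one_lt
  have hs0 := hp.s_pos
  have hτ := tau_ne_zero w
  have hrs : 1 / r < 1 / s := one_div_lt_one_div_of_lt hp.s_pos hsr
  have hs1 : s < 1 := hp.s_lt.trans ha1
  -- The d-neighbourhoods of the two circles must lie in s < |z| < 1 and 1 < |z| < 1/s; there tⁿ,
  -- respectively t⁻ⁿ, decays uniformly.
  obtain ⟨d, hd0, hdd⟩ := exists_between (show 0 < min (min (r - s) (1 - r))
    (min (1 / r - 1) (1 / s - 1 / r)) by
      refine lt_min (lt_min ?_ ?_) (lt_min ?_ ?_) <;> linarith)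
  have hd1 : d < r - s := hdd.trans_le ((min_le_left _ _).trans (min_le_left _ _))
  have hd2 : d < 1 - r := hdd.trans_le ((min_le_left _ _).trans (min_le_right _ _))
  have hd3 : d < 1 / r - 1 := hdd.trans_le ((min_le_right _ _).trans (min_le_left _ _))
  have hd4 : d < 1 / s - 1 / r := hdd.trans_le ((min_le_right _ _).trans (min_le_right _ _))
  set K := closedAnnulus (r - d) (r + d) with hK
  set K' := closedAnnulus (1 / r - d) (1 / r + d) with hK'
  have hKU : K ⊆ annulus s 1 := fun z hz => ⟨by linarith [hz.1], by linarith [hz.2]⟩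
  have hKU' : K' ⊆ annulus 1 (1 / s) := fun z hz => ⟨by linarith [hz.1], by linarith [hz.2]⟩
  have hki : DifferentiableOn ℂ (fun z => -(D z / ((tau w : ℂ) ^ 2 * V z))) (annulus s 1) :=
    ((hp.differentiableOn_ext.mono fun z hz => hz.1).div ((hp.differentiableOn_int.mono
      fun z hz => hz.2.trans (hb1.trans hp.lt_inv)).const_mul _) fun z hz =>
      mul_ne_zero (pow_ne_zero _ hτ) (hp.int_ne_zero z (by linarith [hz.2]))).neg
  have hke : DifferentiableOn ℂ (fun z => (tau w : ℂ) ^ 2 * V z / D z) (annulus 1 (1 / s)) :=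
    ((hp.differentiableOn_int.mono fun z hz => hz.2).const_mul _).div
      (hp.differentiableOn_ext.mono fun z hz => hs1.trans hz.1) fun z hz =>
      hp.ext_ne_zero z (by linarith [hz.1])
  -- This ε makes the factor c₂/d · κ of `isHalving_cauchyTransform` equal to 1/2; the same choice
  -- is made for n₂.
  obtain ⟨n₁, hn₁⟩ := exists_norm_mul_pow_le (isCompact_closedAnnulus (r - d) (r + d))
    (hki.continuousOn.mono hKU) (p := fun z => z) (q := r + d) (by linarith) (by linarith)
    (fun z hz => hz.2) (ε := d / (2 * (r + d))) (by positivity)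
  obtain ⟨n₂, hn₂⟩ := exists_norm_mul_pow_le (isCompact_closedAnnulus (1 / r - d) (1 / r + d))
    (hke.continuousOn.mono hKU') (p := fun z => z⁻¹) (q := (1 / r - d)⁻¹)
    (inv_lt_one_of_one_lt₀ (by linarith)) (inv_nonneg.2 (by linarith))
    (fun z hz => by
      rw [norm_inv]
      exact inv_anti₀ (by linarith) hz.1) (ε := d / (2 * (1 / r + d))) (by positivity)
  refine ⟨K, K', isCompact_closedAnnulus _ _, isCompact_closedAnnulus _ _, hKU, hKU',
    max n₁ n₂, fun n hn => ⟨?_, ?_⟩⟩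
  · have he : ∀ t, intKernel (tau w) D V n t = -(D t / ((tau w : ℂ) ^ 2 * V t)) * t ^ n :=
      fun t => by rw [intKernel]; ring
    refine isHalving_cauchyTransform (κ := d / (2 * (r + d))) hs0.le hd0 (by linarith)
      (by linarith) (by linarith) le_rfl ?_ (fun t ht => ?_) (by field_simp; rfl)
      fun z hz => by linarith [hz.1] |> ne_of_gt
    · exact (hki.mul (by fun_prop : DifferentiableOn ℂ (fun t : ℂ => t ^ n) _)).congr
        fun t _ => he t
    · rw [he]
      exact hn₁ n ((le_max_left _ _).trans hn) t ht
  · have he : ∀ t, extKernel (tau w) D V n t = (tau w : ℂ) ^ 2 * V t / D t * t⁻¹ ^ n :=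
      fun t => by rw [extKernel, div_eq_mul_inv, mul_inv, inv_pow]; ring
    refine isHalving_cauchyTransform (κ := d / (2 * (1 / r + d))) zero_le_one hd0 (by linarith)
      (by linarith) (by linarith) le_rfl ?_ (fun t ht => ?_) (by field_simp; rfl)
      fun z hz => ne_of_lt (by linarith [hz.2])
    · refine (hke.mul (DifferentiableOn.pow (differentiableOn_inv.mono fun t ht => ?_) n)).congr
        fun t _ => he t
      exact norm_pos_iff.1 (zero_lt_one.trans ht.1)
    · rw [he]
      exact hn₂ n ((le_max_right _ _).trans hn) t ht

/-! ### Recursion for the iterates without boundary values -/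

lemma continuousAt_of_differentiableOn_annulus {f : ℂ → ℂ} {α β c : ℝ}
    (hf : DifferentiableOn ℂ f (annulus α β)) (h1 : α < c) (h2 : c < β) {t : ℂ} (ht : ‖t‖ = c) :
    ContinuousAt f t :=
  (hf.differentiableAt ((isOpen_annulus α β).mem_nhds
    ⟨h1.trans_eq ht.symm, ht.trans_lt h2⟩)).continuousAt

/-- An integral over one of the two circles is holomorphic near the other, so every iterate is
continuous on the circle of the next operator and `exteriorValue` is its plain value there. -/
lemma iterF_succ_eq {w : Circle → ℝ} {r s : ℝ} (hr0 : 0 < r) (hsr : s < r) (hr1 : r < 1)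
    (hrs : 1 / r < 1 / s) {n : ℕ} {A A' B B' : Set ℂ}
    (hI : IsHalving (fun f => cauchyTransform r fun t =>
      f t * intKernel (tau w) (szegoExt w) (invSzegoInt w) n t)
      (annulus s 1) A (annulus 1 (1 / s)) B')
    (hE : IsHalving (fun f => cauchyTransform (1 / r) fun t =>
      f t * extKernel (tau w) (szegoExt w) (invSzegoInt w) n t)
      (annulus 1 (1 / s)) A' (annulus s 1) B) (k : ℕ) :
    iterF w r n (2 * k + 1) = (cauchyTransform r fun t =>
      iterF w r n (2 * k) t * intKernel (tau w) (szegoExt w) (invSzegoInt w) n t) ∧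
    iterF w r n (2 * k + 2) = (cauchyTransform (1 / r) fun t =>
      iterF w r n (2 * k + 1) t * extKernel (tau w) (szegoExt w) (invSzegoInt w) n t) := by
  have hr1' : 1 < 1 / r := by rwa [lt_one_div zero_lt_one hr0, one_div_one]
  have h1 : ∀ k, iterF w r n (2 * k + 1) = cauchyInt w r n (iterF w r n (2 * k)) := fun k => by
    rw [iterF, if_pos (even_two_mul k)]
  have h2 : ∀ k, iterF w r n (2 * k + 2) = cauchyExt w r n (iterF w r n (2 * k + 1)) :=
    fun k => by rw [iterF, if_neg (by simp)]
  have step : ∀ k, DifferentiableOn ℂ (iterF w r n (2 * k)) (annulus s 1) →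
      (iterF w r n (2 * k + 1) = (cauchyTransform r fun t =>
        iterF w r n (2 * k) t * intKernel (tau w) (szegoExt w) (invSzegoInt w) n t)) ∧
      iterF w r n (2 * k + 2) = (cauchyTransform (1 / r) fun t =>
        iterF w r n (2 * k + 1) t * extKernel (tau w) (szegoExt w) (invSzegoInt w) n t) := by
    intro k hk
    have e1 := (h1 k).trans (cauchyInt_eq w hr0 n fun t ht =>
      continuousAt_of_differentiableOn_annulus hk hsr hr1 ht)
    have hd : DifferentiableOn ℂ (iterF w r n (2 * k + 1)) (annulus 1 (1 / s)) := by
      rw [e1]; exact hI.differentiableOn _ hk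
    exact ⟨e1, (h2 k).trans (cauchyExt_eq w hr0 n fun t ht =>
      continuousAt_of_differentiableOn_annulus hd hr1' hrs ht)⟩
  have hd : ∀ k, DifferentiableOn ℂ (iterF w r n (2 * k)) (annulus s 1) := by
    intro k
    induction k with
    | zero => exact differentiableOn_const _
    | succ k ih =>
      obtain ⟨e1, e2⟩ := step k ih
      rw [show 2 * (k + 1) = 2 * k + 2 by ring, e2]
      refine hE.differentiableOn _ ?_
      rw [e1]
      exact hI.differentiableOn _ ih
  exact step k (hd k)

lemma iterG_succ_eq {w : Circle → ℝ} {r s : ℝ} (hr0 : 0 < r) (hsr : s < r) (hr1 : r < 1)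
    (hrs : 1 / r < 1 / s) {n : ℕ} {A A' B B' : Set ℂ}
    (hI : IsHalving (fun f => cauchyTransform r fun t =>
      f t * intKernel (tau w) (szegoExt w) (invSzegoInt w) n t)
      (annulus s 1) A (annulus 1 (1 / s)) B')
    (hE : IsHalving (fun f => cauchyTransform (1 / r) fun t =>
      f t * extKernel (tau w) (szegoExt w) (invSzegoInt w) n t)
      (annulus 1 (1 / s)) A' (annulus s 1) B) (k : ℕ) :
    iterG w r n (2 * k + 1) = (cauchyTransform (1 / r) fun t =>
      iterG w r n (2 * k) t * extKernel (tau w) (szegoExt w) (invSzegoInt w) n t) ∧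
    iterG w r n (2 * k + 2) = (cauchyTransform r fun t =>
      iterG w r n (2 * k + 1) t * intKernel (tau w) (szegoExt w) (invSzegoInt w) n t) := by
  have hr1' : 1 < 1 / r := by rwa [lt_one_div zero_lt_one hr0, one_div_one]
  have h1 : ∀ k, iterG w r n (2 * k + 1) = cauchyExt w r n (iterG w r n (2 * k)) := fun k => by
    rw [iterG, if_pos (even_two_mul k)]
  have h2 : ∀ k, iterG w r n (2 * k + 2) = cauchyInt w r n (iterG w r n (2 * k + 1)) :=
    fun k => by rw [iterG, if_neg (by simp)]
  have step : ∀ k, DifferentiableOn ℂ (iterG w r n (2 * k)) (annulus 1 (1 / s)) →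
      (iterG w r n (2 * k + 1) = (cauchyTransform (1 / r) fun t =>
        iterG w r n (2 * k) t * extKernel (tau w) (szegoExt w) (invSzegoInt w) n t)) ∧
      iterG w r n (2 * k + 2) = (cauchyTransform r fun t =>
        iterG w r n (2 * k + 1) t * intKernel (tau w) (szegoExt w) (invSzegoInt w) n t) := by
    intro k hk
    have e1 := (h1 k).trans (cauchyExt_eq w hr0 n fun t ht =>
      continuousAt_of_differentiableOn_annulus hk hr1' hrs ht)
    have hd : DifferentiableOn ℂ (iterG w r n (2 * k + 1)) (annulus s 1) := by
      rw [e1]; exact hE.differentiableOn _ hk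
    exact ⟨e1, (h2 k).trans (cauchyInt_eq w hr0 n fun t ht =>
      continuousAt_of_differentiableOn_annulus hd hsr hr1 ht)⟩
  have hd : ∀ k, DifferentiableOn ℂ (iterG w r n (2 * k)) (annulus 1 (1 / s)) := by
    intro k
    induction k with
    | zero => exact differentiableOn_const _
    | succ k ih =>
      obtain ⟨e1, e2⟩ := step k ih
      rw [show 2 * (k + 1) = 2 * k + 2 by ring, e2]
      refine hI.differentiableOn _ ?_
      rw [e1]
      exact hE.differentiableOn _ ih
  exact step k (hd k)

/-! ### Orthogonal polynomials -/

lemma IsPositiveAnalyticWeight.continuous {w : Circle → ℝ} (hw : IsPositiveAnalyticWeight w) :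
    Continuous w := by
  obtain ⟨W, hW, hWw⟩ := hw.analytic
  have h1 : Continuous fun z : Circle => W z := by
    rw [← continuousOn_univ]
    refine hW.continuousOn.comp continuous_subtype_val.continuousOn fun z _ => ?_
    exact mem_sphere_zero_iff_norm.2 (Circle.norm_coe z)
  have h2 : w = fun z : Circle => (W z).re := by
    ext z
    rw [hWw, Complex.ofReal_re]
  rw [h2]
  exact Complex.continuous_re.comp h1

section ScalarProduct

variable {w : Circle → ℝ}

lemma continuous_circle_exp_coe : Continuous fun θ : ℝ => (Circle.exp θ : ℂ) :=
  continuous_subtype_val.comp Circle.exp.continuous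

lemma continuous_scalarProduct_integrand (hw : IsPositiveAnalyticWeight w) (p q : ℂ[X]) :
    Continuous fun θ : ℝ => p.eval (Circle.exp θ : ℂ) *
      (starRingEnd ℂ) (q.eval (Circle.exp θ : ℂ)) * (w (Circle.exp θ) : ℂ) :=
  ((p.continuous.comp continuous_circle_exp_coe).mul
    (Complex.continuous_conj.comp (q.continuous.comp continuous_circle_exp_coe))).mul
    (Complex.continuous_ofReal.comp (hw.continuous.comp Circle.exp.continuous))

lemma scalarProduct_add_left (hw : IsPositiveAnalyticWeight w) (p p' q : ℂ[X]) :
    scalarProduct w (p + p') q = scalarProduct w p q + scalarProduct w p' q := by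
  unfold scalarProduct
  rw [← intervalIntegral.integral_add
    ((continuous_scalarProduct_integrand hw p q).intervalIntegrable _ _)
    ((continuous_scalarProduct_integrand hw p' q).intervalIntegrable _ _)]
  simp only [eval_add, add_mul]

lemma scalarProduct_C_mul_left (c : ℂ) (p q : ℂ[X]) :
    scalarProduct w (C c * p) q = c * scalarProduct w p q := by
  unfold scalarProduct
  rw [← intervalIntegral.integral_const_mul]
  simp only [eval_mul, eval_C, mul_assoc]

lemma scalarProduct_conj (p q : ℂ[X]) :
    (starRingEnd ℂ) (scalarProduct w p q) = scalarProduct w q p := by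
  unfold scalarProduct
  rw [intervalIntegral.integral_of_le (by positivity),
    intervalIntegral.integral_of_le (by positivity), ← integral_conj]
  congr 1
  ext θ
  simp only [map_mul, Complex.conj_conj, Complex.conj_ofReal]
  ring

lemma scalarProduct_add_right (hw : IsPositiveAnalyticWeight w) (p q q' : ℂ[X]) :
    scalarProduct w p (q + q') = scalarProduct w p q + scalarProduct w p q' := by
  rw [← scalarProduct_conj, scalarProduct_add_left hw, map_add, scalarProduct_conj,
    scalarProduct_conj]

lemma scalarProduct_C_mul_right (c : ℂ) (p q : ℂ[X]) :
    scalarProduct w p (C c * q) = (starRingEnd ℂ) c * scalarProduct w p q := by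
  rw [← scalarProduct_conj, scalarProduct_C_mul_left, map_mul, scalarProduct_conj]

lemma scalarProduct_self (p : ℂ[X]) : scalarProduct w p p =
    ((∫ θ in (0 : ℝ)..(2 * Real.pi), Complex.normSq (p.eval (Circle.exp θ : ℂ)) *
      w (Circle.exp θ) : ℝ) : ℂ) := by
  unfold scalarProduct
  rw [← intervalIntegral.integral_ofReal]
  simp only [Complex.mul_conj, Complex.ofReal_mul]

lemma scalarProduct_self_pos (hw : IsPositiveAnalyticWeight w) {p : ℂ[X]} (hp : p ≠ 0) :
    0 < (scalarProduct w p p).re := by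
  rw [scalarProduct_self, Complex.ofReal_re]
  refine intervalIntegral.integral_pos (by positivity) (Continuous.continuousOn ?_)
    (fun θ _ => mul_nonneg (Complex.normSq_nonneg _) (hw.pos _).le) ?_
  · exact (Complex.continuous_normSq.comp (p.continuous.comp continuous_circle_exp_coe)).mul
      (hw.continuous.comp Circle.exp.continuous)
  · by_contra! hcon
    refine hp (eq_zero_of_infinite_isRoot p (Set.Infinite.mono (s := Metric.sphere (0 : ℂ) 1) ?_
      ?_))
    · intro z hz
      have hz' := hz
      rw [← abs_of_pos (zero_lt_one' ℝ), ← image_circleMap_Ioc] at hz'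
      obtain ⟨θ, hθ, rfl⟩ := hz'
      have h := hcon θ (Set.Ioc_subset_Icc_self hθ)
      have h' := nonpos_of_mul_nonpos_left h (hw.pos _)
      have h'' := Complex.normSq_eq_zero.1 (le_antisymm h' (Complex.normSq_nonneg _))
      rwa [coe_circle_exp] at h''
    · refine (isPreconnected_sphere (by rw [Complex.rank_real_complex]; norm_num) 0
        1).infinite_of_nontrivial ⟨1, by simp, -1, by simp, ?_⟩
      norm_num

/-- Gram–Schmidt applied to the monomials. Each unnormalized vector is Xⁿ minus terms of lower
degree, hence monic, and normalizing gives a positive leading coefficient. -/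
lemma exists_isOrthonormalSequence (hw : IsPositiveAnalyticWeight w) :
    ∃ φ : ℕ → ℂ[X], IsOrthonormalSequence w φ := by
  let core : InnerProductSpace.Core ℂ ℂ[X] :=
    -- The arguments are swapped because `inner` is conjugate-linear in its first slot.
    { inner := fun p q => scalarProduct w q p
      conj_inner_symm := fun p q => scalarProduct_conj _ _
      re_inner_nonneg := fun p => by
        rcases eq_or_ne p 0 with rfl | hp
        · simp [scalarProduct]
        · exact (scalarProduct_self_pos hw hp).le
      add_left := fun p q q' => scalarProduct_add_right hw _ _ _
      smul_left := fun p q c => by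
        rw [smul_eq_C_mul]
        exact scalarProduct_C_mul_right _ _ _
      definite := fun p hp => by
        by_contra h
        have := scalarProduct_self_pos hw h
        rw [hp] at this
        simp at this }
  let _ : NormedAddCommGroup ℂ[X] := core.toNormedAddCommGroup
  let : InnerProductSpace ℂ ℂ[X] := InnerProductSpace.ofCore core.toCore
  let f : ℕ → ℂ[X] := fun n => X ^ n
  have hlin : LinearIndependent ℂ f := by
    have := (basisMonomials ℂ).linearIndependent
    rw [coe_basisMonomials] at this
    simpa only [monomial_one_right_eq_X_pow] using this
  let g : ℕ → ℂ[X] := InnerProductSpace.gramSchmidt ℂ f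
  have hg : ∀ n, (g n).degree = n ∧ (g n).leadingCoeff = 1 := by
    intro n
    induction n using Nat.strong_induction_on with
    | _ n ih =>
      have h1 := InnerProductSpace.gramSchmidt_def'' ℂ f n
      set q := ∑ i ∈ Finset.Iio n, (inner ℂ (InnerProductSpace.gramSchmidt ℂ f i) (f n) /
        (‖InnerProductSpace.gramSchmidt ℂ f i‖ : ℂ) ^ 2) • InnerProductSpace.gramSchmidt ℂ f i
        with hq
      have hqn : q ∈ degreeLT ℂ n := by
        refine Submodule.sum_mem _ fun i hi => Submodule.smul_mem _ _ ?_
        rw [mem_degreeLT]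
        have := (ih i (Finset.mem_Iio.1 hi)).1
        change (g i).degree < n
        rw [this]
        exact_mod_cast Finset.mem_Iio.1 hi
      rw [mem_degreeLT] at hqn
      have hgn : g n = X ^ n - q := eq_sub_of_add_eq h1.symm
      have hlt : q.degree < (X ^ n : ℂ[X]).degree := by rwa [degree_X_pow]
      rw [hgn]
      exact ⟨by rw [degree_sub_eq_left_of_degree_lt hlt, degree_X_pow],
        by rw [leadingCoeff_sub_of_degree_lt hlt, leadingCoeff_X_pow]⟩
  have hpos : ∀ n, 0 < ‖g n‖ := fun n => norm_pos_iff.2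
    (InnerProductSpace.gramSchmidt_ne_zero n hlin)
  have horth := InnerProductSpace.gramSchmidtNormed_orthonormal hlin
  have hval : ∀ n, InnerProductSpace.gramSchmidtNormed ℂ f n = C ((‖g n‖⁻¹ : ℝ) : ℂ) * g n := by
    intro n
    rw [← smul_eq_C_mul, Complex.ofReal_inv]
    rfl
  have hlc : ∀ n, (C ((‖g n‖⁻¹ : ℝ) : ℂ) * g n).leadingCoeff = ((‖g n‖⁻¹ : ℝ) : ℂ) := fun n => by
    rw [leadingCoeff_mul, leadingCoeff_C, (hg n).2, mul_one]
  refine ⟨fun n => C ((‖g n‖⁻¹ : ℝ) : ℂ) * g n, fun n => ?_, fun n => ?_, fun n => ?_,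
    fun m n => ?_⟩
  · rw [degree_C_mul, (hg n).1]
    exact Complex.ofReal_ne_zero.2 (inv_ne_zero (hpos n).ne')
  · simp only [hlc, Complex.ofReal_im]
  · simp only [hlc, Complex.ofReal_re]
    exact inv_pos.2 (hpos n)
  · have := orthonormal_iff_ite.1 horth m n
    rw [hval, hval] at this
    exact this

end ScalarProduct

namespace IsOrthonormalSequence

variable {w : Circle → ℝ} {φ : ℕ → ℂ[X]}

lemma coeff_eq (hφ : IsOrthonormalSequence w φ) (n : ℕ) : (φ n).coeff n = kappa φ n := by
  have h := natDegree_eq_of_degree_eq_some (hφ.degree_eq n)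
  have h' : (φ n).coeff n = (φ n).leadingCoeff := by rw [leadingCoeff, h]
  rw [h', kappa]
  exact Complex.ext (by simp) (by simp [hφ.leadingCoeff_im n])

lemma kappa_pos (hφ : IsOrthonormalSequence w φ) (n : ℕ) : 0 < kappa φ n :=
  hφ.leadingCoeff_pos n

lemma kappa_ne_zero (hφ : IsOrthonormalSequence w φ) (n : ℕ) : (kappa φ n : ℂ) ≠ 0 :=
  Complex.ofReal_ne_zero.2 (hφ.kappa_pos n).ne'

lemma natDegree_eq (hφ : IsOrthonormalSequence w φ) (n : ℕ) : (φ n).natDegree = n :=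
  natDegree_eq_of_degree_eq_some (hφ.degree_eq n)

lemma scalarProduct_eq_zero (hφ : IsOrthonormalSequence w φ) (hw : IsPositiveAnalyticWeight w)
    {n m : ℕ} (hmn : m ≤ n) {q : ℂ[X]} (hq : q.degree < m) : scalarProduct w (φ n) q = 0 := by
  induction m generalizing q with
  | zero =>
    have : q = 0 := by
      rw [← degree_eq_bot]
      exact Nat.WithBot.lt_zero_iff.1 hq
    simp [this, scalarProduct]
  | succ m ih =>
    set c := q.coeff m / (kappa φ m : ℂ) with hc
    have hdec : q = (q + C (-c) * φ m) + C c * φ m := by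
      rw [C_neg]; ring
    have hdeg : (q + C (-c) * φ m).degree < m := by
      rw [degree_lt_iff_coeff_zero] at hq ⊢
      intro j hj
      rw [coeff_add, coeff_C_mul]
      rcases hj.eq_or_lt with rfl | hj
      · rw [hφ.coeff_eq, hc, neg_mul, div_mul_cancel₀ _ (hφ.kappa_ne_zero _), add_neg_cancel]
      · rw [hq j hj, coeff_eq_zero_of_natDegree_lt (by rwa [hφ.natDegree_eq]), mul_zero, add_zero]
    rw [hdec, scalarProduct_add_right hw, ih (by omega) hdeg, scalarProduct_C_mul_right,
      hφ.orthonormal, if_neg (by omega), mul_zero, add_zero]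

lemma scalarProduct_eq_coeff (hφ : IsOrthonormalSequence w φ) (hw : IsPositiveAnalyticWeight w)
    {n : ℕ} {q : ℂ[X]} (hq : q.natDegree ≤ n) :
    scalarProduct w (φ n) q = (starRingEnd ℂ) (q.coeff n) / kappa φ n := by
  set c := q.coeff n / (kappa φ n : ℂ) with hc
  have hdec : q = (q + C (-c) * φ n) + C c * φ n := by
    rw [C_neg]; ring
  have hdeg : (q + C (-c) * φ n).degree < n := by
    rw [degree_lt_iff_coeff_zero]
    intro j hj
    rw [coeff_add, coeff_C_mul]
    rcases hj.eq_or_lt with rfl | hj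
    · rw [hφ.coeff_eq, hc, neg_mul, div_mul_cancel₀ _ (hφ.kappa_ne_zero _), add_neg_cancel]
    · rw [coeff_eq_zero_of_natDegree_lt (hq.trans_lt hj),
        coeff_eq_zero_of_natDegree_lt (by rwa [hφ.natDegree_eq]), mul_zero, add_zero]
  conv_lhs => rw [hdec]
  rw [scalarProduct_add_right hw, hφ.scalarProduct_eq_zero hw le_rfl hdeg,
    scalarProduct_C_mul_right, hφ.orthonormal, if_pos rfl, mul_one, zero_add, hc, map_div₀,
    Complex.conj_ofReal]

/-- The scalar product of φ_n with ψ_n is κ(ψ)/κ(φ), and in the other order it is the reciprocal.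
Both being real, κ(φ) = κ(ψ), and then ‖φ_n - ψ_n‖² = 1 - 1 - 1 + 1 = 0. -/
lemma unique (hw : IsPositiveAnalyticWeight w) {ψ : ℕ → ℂ[X]} (hφ : IsOrthonormalSequence w φ)
    (hψ : IsOrthonormalSequence w ψ) : φ = ψ := by
  funext n
  have h1 := hφ.scalarProduct_eq_coeff hw (hψ.natDegree_eq n).le
  have h2 := hψ.scalarProduct_eq_coeff hw (hφ.natDegree_eq n).le
  rw [hψ.coeff_eq, Complex.conj_ofReal] at h1
  rw [hφ.coeff_eq, Complex.conj_ofReal] at h2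
  have h3 := h2
  rw [← scalarProduct_conj, h1, map_div₀, Complex.conj_ofReal, Complex.conj_ofReal,
    div_eq_div_iff (hφ.kappa_ne_zero n) (hψ.kappa_ne_zero n)] at h3
  have hk : kappa ψ n = kappa φ n := by
    have h4 : kappa ψ n * kappa ψ n = kappa φ n * kappa φ n := by exact_mod_cast h3
    exact (mul_self_inj (hψ.kappa_pos n).le (hφ.kappa_pos n).le).1 h4
  rw [hk, div_self (hφ.kappa_ne_zero n)] at h1 h2
  have h5 : scalarProduct w (φ n + C (-1) * ψ n) (φ n + C (-1) * ψ n) = 0 := by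
    rw [scalarProduct_add_left hw, scalarProduct_add_right hw, scalarProduct_add_right hw,
      scalarProduct_C_mul_left, scalarProduct_C_mul_left, scalarProduct_C_mul_right,
      scalarProduct_C_mul_right, h1, h2, hφ.orthonormal, hψ.orthonormal]
    simp
  by_contra h
  have h6 : φ n + C (-1) * ψ n ≠ 0 := fun h0 => h (by
    rw [C_neg, C_1, neg_one_mul, ← sub_eq_add_neg, sub_eq_zero] at h0
    exact h0)
  have := scalarProduct_self_pos hw h6
  rw [h5] at this
  simp at this

lemma scalarProduct_monic_X_pow (hφ : IsOrthonormalSequence w φ)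
    (hw : IsPositiveAnalyticWeight w) {n j : ℕ} (hj : j < n) :
    scalarProduct w (monicOPUC φ n) (X ^ j) = 0 := by
  rw [monicOPUC, scalarProduct_C_mul_left, hφ.scalarProduct_eq_zero hw le_rfl
    (by rw [degree_X_pow]; exact_mod_cast hj), mul_zero]

lemma eval_reversed (hφ : IsOrthonormalSequence w φ) (n : ℕ) (θ : ℝ) :
    (reversed φ n).eval (Circle.exp θ : ℂ) =
      (Circle.exp θ : ℂ) ^ n * (starRingEnd ℂ) ((φ n).eval (Circle.exp θ : ℂ)) := by
  have he : (Circle.exp θ : ℂ) ≠ 0 := Circle.coe_ne_zero _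
  have hc : (starRingEnd ℂ) (Circle.exp θ : ℂ) = (Circle.exp θ : ℂ)⁻¹ := by
    rw [← Circle.coe_inv_eq_conj, Circle.coe_inv]
  let : Invertible (Circle.exp θ : ℂ)⁻¹ := invertibleOfNonzero (inv_ne_zero he)
  have h := eval₂_reflect_mul_pow (RingHom.id ℂ) (Circle.exp θ : ℂ)⁻¹ n
    ((φ n).map (starRingEnd ℂ)) (by
      rw [natDegree_map, hφ.natDegree_eq])
  rw [invOf_eq_inv, inv_inv] at h
  have h2 : (starRingEnd ℂ) ((φ n).eval (Circle.exp θ : ℂ)) =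
      ((φ n).map (starRingEnd ℂ)).eval (Circle.exp θ : ℂ)⁻¹ := by
    rw [← hc, eval_map, eval₂_at_apply]
  rw [h2, reversed]
  change eval _ _ * _ = eval _ _ at h
  rw [← h, inv_pow, mul_comm, mul_assoc, inv_mul_cancel₀ (pow_ne_zero _ he), mul_one]

/-- On the circle, φ_n^* t⁻ʲ is the conjugate of φ_n times the conjugate of tⁿ⁻ʲ; orthogonality of
φ_n leaves only j = 0. -/
lemma scalarProduct_reversed_X_pow (hφ : IsOrthonormalSequence w φ)
    (hw : IsPositiveAnalyticWeight w) {n j : ℕ} (hj : j ≤ n) :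
    scalarProduct w (reversed φ n) (X ^ j) = if j = 0 then ((kappa φ n : ℂ))⁻¹ else 0 := by
  have h1 : scalarProduct w (reversed φ n) (X ^ j) =
      (starRingEnd ℂ) (scalarProduct w (φ n) (X ^ (n - j))) := by
    rw [scalarProduct_conj]
    unfold scalarProduct
    congr 1
    ext θ
    have he : (Circle.exp θ : ℂ) ≠ 0 := Circle.coe_ne_zero _
    have hc : (starRingEnd ℂ) (Circle.exp θ : ℂ) = (Circle.exp θ : ℂ)⁻¹ := by
      rw [← Circle.coe_inv_eq_conj, Circle.coe_inv]
    rw [hφ.eval_reversed, eval_pow, eval_pow, eval_X, map_pow, hc, pow_sub₀ _ he hj, inv_pow]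
    ring
  rw [h1]
  split_ifs with h0
  · subst h0
    rw [hφ.scalarProduct_eq_coeff hw (by simp)]
    simp
  · rw [hφ.scalarProduct_eq_zero hw le_rfl (by rw [degree_X_pow]; exact_mod_cast (by omega)),
      map_zero]

end IsOrthonormalSequence

/-! ### Behaviour at infinity -/

lemma tendsto_eval_div_pow {P : ℂ[X]} {n : ℕ} (hP : P.natDegree ≤ n) :
    Tendsto (fun z => P.eval z / z ^ n) (Bornology.cobounded ℂ) (𝓝 (P.coeff n)) := by
  have h := ((P.reflect n).continuous.tendsto 0).comp (tendsto_inv₀_cobounded (α := ℂ))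
  have h0 : (P.reflect n).eval 0 = P.coeff n := by
    rw [← coeff_zero_eq_eval_zero, coeff_reflect]
    simp
  rw [h0] at h
  refine h.congr' ?_
  filter_upwards [tendsto_norm_cobounded_atTop.eventually_gt_atTop 0] with z hz
  have hz0 : z ≠ 0 := norm_pos_iff.1 hz
  let : Invertible z := invertibleOfNonzero hz0
  have h1 := eval₂_reflect_mul_pow (RingHom.id ℂ) z n P hP
  rw [invOf_eq_inv] at h1
  change eval _ _ * _ = eval _ _ at h1
  rw [← h1, mul_div_cancel_right₀ _ (pow_ne_zero _ hz0)]
  rfl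

/-- If the moments of `h` of index `1, …, n` vanish, then `zⁿ⁺¹` times the Cauchy integral of
`h t⁻ⁿ⁻¹` differs from the Cauchy integral of `h` only by the moment of index `0`. -/
lemma pow_mul_cauchyTransform {h : ℂ → ℂ} (hh : ContinuousOn h (Metric.sphere 0 1)) {n : ℕ}
    {z : ℂ} (hz : ‖z‖ ≠ 1) (hm : ∀ j, 1 ≤ j → j < n + 1 →
      ∮ t in C(0, 1), h t / t ^ (j + 1) = 0) :
    z ^ (n + 1) * cauchyTransform 1 (fun t => h t / t ^ (n + 1)) z =
      cauchyTransform 1 h z - (2 * Real.pi * Complex.I)⁻¹ * ∮ t in C(0, 1), h t / t := by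
  have hd : ∀ j, ContinuousOn (fun t => h t / t ^ j) (Metric.sphere (0 : ℂ) 1) := fun j =>
    hh.div (by fun_prop) fun t ht => pow_ne_zero _ (by
      rintro rfl
      simp at ht)
  -- Partial fractions: z/(t(t - z)) = 1/(t - z) - 1/t.
  have step : ∀ j, z * cauchyTransform 1 (fun t => h t / t ^ (j + 1)) z =
      cauchyTransform 1 (fun t => h t / t ^ j) z -
        (2 * Real.pi * Complex.I)⁻¹ * ∮ t in C(0, 1), h t / t ^ (j + 1) := by
    intro j
    unfold cauchyTransform
    rw [mul_left_comm, ← mul_sub, ← circleIntegral.integral_const_mul,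
      ← circleIntegral.integral_sub
      ((continuousOn_div_sub (hd j) hz).circleIntegrable zero_le_one)
      ((hd (j + 1)).circleIntegrable zero_le_one)]
    congr 1
    refine circleIntegral.integral_congr zero_le_one fun t ht => ?_
    have ht' : ‖t‖ = 1 := by simpa using ht
    have h1 : t ≠ 0 := by
      rintro rfl
      simp at ht'
    have h2 : t - z ≠ 0 := ne_of_norm_ne (by rw [ht']; exact hz.symm)
    simp only
    field_simp
    ring
  induction n with
  | zero => simpa using step 0
  | succ n ih =>
    rw [pow_succ, mul_assoc, step (n + 1), hm (n + 1) (by omega) (by omega), mul_zero, sub_zero]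
    exact ih fun j h1 h2 => hm j h1 (by omega)

/-! ### The rows of the Riemann–Hilbert matrix -/

section Rows

variable {w : Circle → ℝ} {s a b : ℝ} {D V : ℂ → ℂ}

lemma IsSzegoPair.circleIntegral_eq (hp : IsSzegoPair w s a b D V) (P g : ℂ → ℂ) :
    ∮ t in C(0, 1), P t / (V t * D t) * g t = ∫ θ in (0 : ℝ)..(2 * Real.pi),
      P (Circle.exp θ : ℂ) * (w (Circle.exp θ) : ℂ) * g (Circle.exp θ : ℂ) *
        (Complex.I * (Circle.exp θ : ℂ)) := by
  unfold circleIntegral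
  congr 1
  ext θ
  rw [deriv_circleMap, smul_eq_mul, ← coe_circle_exp,
    eq_inv_of_mul_eq_one_left (hp.weight_mul (Circle.exp θ))]
  ring

lemma IsSzegoPair.circleIntegral_moment (hp : IsSzegoPair w s a b D V) (Q : ℂ[X]) (j : ℕ) :
    ∮ t in C(0, 1), Q.eval t / (V t * D t) / t ^ (j + 1) =
      Complex.I * scalarProduct w Q (X ^ j) := by
  have h := hp.circleIntegral_eq (fun t => Q.eval t) fun t => (t ^ (j + 1))⁻¹
  simp only [← div_eq_mul_inv] at h
  rw [h, scalarProduct, ← intervalIntegral.integral_const_mul]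
  congr 1
  ext θ
  have he : (Circle.exp θ : ℂ) ≠ 0 := Circle.coe_ne_zero _
  have hc : (starRingEnd ℂ) (Circle.exp θ : ℂ) = (Circle.exp θ : ℂ)⁻¹ := by
    rw [← Circle.coe_inv_eq_conj, Circle.coe_inv]
  rw [eval_pow, eval_X, map_pow, hc, inv_pow]
  field_simp
  ring

lemma IsSzegoPair.cauchyTransform_rowDensity (hp : IsSzegoPair w s a b D V) (n : ℕ) (Q : ℂ[X])
    (z : ℂ) : cauchyTransform 1 (rowDensity D V n fun t => Q.eval t) z =
      (2 * Real.pi * Complex.I)⁻¹ * ∫ θ in (0 : ℝ)..(2 * Real.pi),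
        Q.eval (Circle.exp θ : ℂ) * (w (Circle.exp θ) : ℂ) /
          ((Circle.exp θ : ℂ) ^ n * ((Circle.exp θ : ℂ) - z)) *
          (Complex.I * (Circle.exp θ : ℂ)) := by
  have h := hp.circleIntegral_eq (fun t => Q.eval t) fun t => (t ^ n * (t - z))⁻¹
  simp only [← div_eq_mul_inv] at h
  rw [cauchyTransform, ← h]
  congr 2
  ext t
  rw [rowDensity, div_div, div_div]
  congr 1
  ring

/-- The Cauchy integral without the power of t tends to 0 at infinity, so only the moment of index 0
survives. This is where orthogonality enters the limits β of the rows. -/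
lemma IsSzegoPair.tendsto_pow_mul_cauchyTransform (hp : IsSzegoPair w s a b D V) (n : ℕ)
    (Q : ℂ[X]) (hQ : ∀ j, 1 ≤ j → j < n + 1 → scalarProduct w Q (X ^ j) = 0) :
    Tendsto (fun z => z ^ (n + 1) *
      cauchyTransform 1 (rowDensity D V (n + 1) fun t => Q.eval t) z)
      (Bornology.cobounded ℂ) (𝓝 (-(2 * Real.pi : ℂ)⁻¹ * scalarProduct w Q 1)) := by
  have hsph : Metric.sphere (0 : ℂ) 1 ⊆ annulus a b := sphere_subset_annulus hp.lt_one hp.one_lt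
  have hh : ContinuousOn (fun t => Q.eval t / (V t * D t)) (Metric.sphere (0 : ℂ) 1) := by
    have := (hp.differentiableOn_rowDensity 0 (P := fun t => Q.eval t)
      Q.differentiable).continuousOn.mono hsph
    unfold rowDensity at this
    simpa only [pow_zero, one_mul] using this
  have hlim := (tendsto_cauchyTransform_zero zero_le_one hh).sub_const
    ((2 * Real.pi * Complex.I)⁻¹ * ∮ t in C(0, 1), Q.eval t / (V t * D t) / t)
  have h0 := hp.circleIntegral_moment Q 0
  simp only [zero_add, pow_one, pow_zero] at h0
  have hc : 0 - (2 * Real.pi * Complex.I)⁻¹ * ∮ t in C(0, 1), Q.eval t / (V t * D t) / t =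
      -(2 * Real.pi : ℂ)⁻¹ * scalarProduct w Q 1 := by
    rw [h0, mul_inv, zero_sub, neg_mul, mul_assoc, inv_mul_cancel_left₀ Complex.I_ne_zero]
  rw [hc] at hlim
  refine hlim.congr' ?_
  filter_upwards [tendsto_norm_cobounded_atTop.eventually_gt_atTop 1] with z hz
  rw [← pow_mul_cauchyTransform hh hz.ne' (n := n)]
  · congr 1
    refine cauchyTransform_congr zero_le_one (fun t _ => ?_) z
    rw [rowDensity, div_div, mul_comm (V t * D t)]
  · intro j h1 h2
    rw [hp.circleIntegral_moment, hQ j h1 h2, mul_zero]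

end Rows

/-! ### The product Y H K N⁻¹, region by region -/

lemma fin_two_congr {x₁ x₂ x₃ x₄ y₁ y₂ y₃ y₄ : ℂ} (h₁ : x₁ = y₁) (h₂ : x₂ = y₂) (h₃ : x₃ = y₃)
    (h₄ : x₄ = y₄) : !![x₁, x₂; x₃, x₄] = !![y₁, y₂; y₃, y₄] := by
  rw [h₁, h₂, h₃, h₄]

lemma mul_matH_matK_inv_matN {w : Circle → ℝ} {r s a b : ℝ}
    (hp : IsSzegoPair w s a b (szegoExt w) (invSzegoInt w)) (hr0 : 0 < r) (hra : r < a)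
    (n : ℕ) {z : ℂ} (h1 : ‖z‖ ≠ r) (h2 : ‖z‖ ≠ 1) (h3 : ‖z‖ ≠ 1 / r) (q y q' y' : ℂ) :
    !![q, y; q', y'] * matH n z * matK w r n z * (matN w z)⁻¹ =
      if ‖z‖ < r then
        !![tau w * invSzegoInt w z * y, -(q / (tau w * invSzegoInt w z));
          tau w * invSzegoInt w z * y', -(q' / (tau w * invSzegoInt w z))]
      else if ‖z‖ < 1 then
        !![tau w * invSzegoInt w z * y,
            z ^ n * szegoExt w z * y / tau w - q / (tau w * invSzegoInt w z);
          tau w * invSzegoInt w z * y',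
            z ^ n * szegoExt w z * y' / tau w - q' / (tau w * invSzegoInt w z)]
      else if ‖z‖ < 1 / r then
        !![tau w * q / (z ^ n * szegoExt w z) + tau w * invSzegoInt w z * y,
            z ^ n * szegoExt w z * y / tau w;
          tau w * q' / (z ^ n * szegoExt w z) + tau w * invSzegoInt w z * y',
            z ^ n * szegoExt w z * y' / tau w]
      else
        !![tau w * q / (z ^ n * szegoExt w z), z ^ n * szegoExt w z * y / tau w;
          tau w * q' / (z ^ n * szegoExt w z), z ^ n * szegoExt w z * y' / tau w] := by
  have hτ := tau_ne_zero w
  have hr1 : r < 1 := hra.trans hp.lt_one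
  have hr1' : 1 < 1 / r := by rwa [lt_one_div zero_lt_one hr0, one_div_one]
  rcases lt_or_gt_of_ne h2 with hz | hz
  · have hV : invSzegoInt w z ≠ 0 := hp.int_ne_zero z (hz.trans hp.one_lt)
    have hN : (matN w z)⁻¹ =
        !![0, -(tau w * invSzegoInt w z)⁻¹; tau w * invSzegoInt w z, 0] := by
      refine Matrix.inv_eq_right_inv ?_
      rw [matN, if_neg hz.not_gt, szegoInt, Matrix.mul_fin_two, Matrix.one_fin_two]
      field_simp
      simp
    have hH : matH n z = 1 := if_neg hz.not_gt
    rw [hN, hH, mul_one]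
    rcases lt_or_gt_of_ne h1 with hzr | hzr
    · have hK : matK w r n z = 1 := by
        rw [matK, if_neg (fun h => by linarith [h.1]), if_neg (fun h => by linarith [h.1])]
      rw [hK, mul_one, if_pos hzr, Matrix.mul_fin_two]
      simp only [mul_zero, zero_add, add_zero, mul_neg, div_eq_mul_inv]
      refine fin_two_congr ?_ ?_ ?_ ?_ <;> ring
    -- This also holds at zeros of D_e: there `weightExt` is 0 by convention, so zⁿ/w is 0, its
    -- correct value.
    · have hK : matK w r n z =
          !![1, 0; -(z ^ n * szegoExt w z * invSzegoInt w z), 1] := by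
        rw [matK, if_pos ⟨hzr, hz⟩]
        refine Matrix.inv_eq_right_inv ?_
        rw [Matrix.mul_fin_two, Matrix.one_fin_two, weightExt, szegoInt, div_div_eq_mul_div,
          div_inv_eq_mul]
        simp
      rw [hK, if_neg hzr.not_gt, if_pos hz, Matrix.mul_fin_two, Matrix.mul_fin_two]
      refine fin_two_congr ?_ ?_ ?_ ?_ <;> first | ring1 | (field_simp; ring1)
  · have hz0 : z ^ n ≠ 0 := pow_ne_zero _ (norm_pos_iff.1 (zero_lt_one.trans hz))
    have hD : szegoExt w z ≠ 0 := hp.ext_ne_zero z (hp.lt_one.trans hz)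
    have hN : (matN w z)⁻¹ = !![tau w / szegoExt w z, 0; 0, szegoExt w z / tau w] := by
      refine Matrix.inv_eq_right_inv ?_
      rw [matN, if_pos hz, Matrix.mul_fin_two, Matrix.one_fin_two]
      field_simp
      simp
    have hH : matH n z = !![(z ^ n)⁻¹, 0; 0, z ^ n] := if_pos hz
    rw [hN, hH, if_neg (by linarith), if_neg hz.not_gt]
    rcases lt_or_gt_of_ne h3 with hzr | hzr
    · have hK : matK w r n z = !![1, 0; szegoExt w z * invSzegoInt w z / z ^ n, 1] := by
        rw [matK, if_neg (fun h => by linarith [h.2]), if_pos ⟨hz, hzr⟩, weightExt, szegoInt,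
          ← mul_div_assoc, one_div_div, div_mul_eq_div_div, div_inv_eq_mul]
        refine fin_two_congr rfl rfl ?_ rfl
        ring
      rw [hK, if_pos hzr, Matrix.mul_fin_two, Matrix.mul_fin_two, Matrix.mul_fin_two]
      refine fin_two_congr ?_ ?_ ?_ ?_ <;> first | ring1 | (field_simp; ring1)
    · have hK : matK w r n z = 1 := by
        rw [matK, if_neg (fun h => by linarith [h.2]), if_neg (fun h => by linarith [h.2])]
      rw [hK, mul_one, if_neg hzr.not_gt, Matrix.mul_fin_two, Matrix.mul_fin_two]
      refine fin_two_congr ?_ ?_ ?_ ?_ <;> ring1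

/-- Absorbing -2πκ_{n-1} into the polynomial gives both rows the same shape, so one lemma treats
both. -/
lemma IsSzegoPair.matY_eq {w : Circle → ℝ} {s a b : ℝ} {D V : ℂ → ℂ}
    (hp : IsSzegoPair w s a b D V) (φ : ℕ → ℂ[X]) (n : ℕ) (z : ℂ) :
    matY w φ n z =
      !![(monicOPUC φ n).eval z,
          cauchyTransform 1 (rowDensity D V n fun t => (monicOPUC φ n).eval t) z;
        (C (-2 * Real.pi * (kappa φ (n - 1) : ℂ)) * reversed φ (n - 1)).eval z,
          cauchyTransform 1 (rowDensity D V n fun t =>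
            (C (-2 * Real.pi * (kappa φ (n - 1) : ℂ)) * reversed φ (n - 1)).eval t) z] := by
  rw [hp.cauchyTransform_rowDensity, hp.cauchyTransform_rowDensity, matY]
  refine fin_two_congr rfl ?_ ?_ ?_
  · rw [one_div]
  · simp
  · simp only [eval_mul, eval_C, mul_assoc, mul_div_assoc]
    rw [intervalIntegral.integral_const_mul, intervalIntegral.integral_const_mul]
    have hpi : (Real.pi : ℂ) ≠ 0 := by exact_mod_cast Real.pi_ne_zero
    simp only [intervalIntegral.integral_const_mul]
    field_simp

/-! ### The canonical representation -/

lemma IsOrthonormalSequence.monicOPUC_natDegree_le {w : Circle → ℝ} {φ : ℕ → ℂ[X]}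
    (hφ : IsOrthonormalSequence w φ) (n : ℕ) : (monicOPUC φ n).natDegree ≤ n :=
  (natDegree_C_mul_le _ _).trans (hφ.natDegree_eq n).le

lemma IsOrthonormalSequence.coeff_monicOPUC {w : Circle → ℝ} {φ : ℕ → ℂ[X]}
    (hφ : IsOrthonormalSequence w φ) (n : ℕ) : (monicOPUC φ n).coeff n = 1 := by
  rw [monicOPUC, coeff_C_mul, hφ.coeff_eq, inv_mul_cancel₀ (hφ.kappa_ne_zero n)]

lemma IsOrthonormalSequence.natDegree_reversed_le {w : Circle → ℝ} {φ : ℕ → ℂ[X]}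
    (hφ : IsOrthonormalSequence w φ) (n : ℕ) : (reversed φ n).natDegree ≤ n := by
  refine natDegree_reflect_le.trans (max_le le_rfl ?_)
  rw [natDegree_map, hφ.natDegree_eq]

lemma IsOrthonormalSequence.eval_reversed_zero {w : Circle → ℝ} {φ : ℕ → ℂ[X]}
    (hφ : IsOrthonormalSequence w φ) (n : ℕ) : (reversed φ n).eval 0 = kappa φ n := by
  rw [← coeff_zero_eq_eval_zero, reversed, coeff_reflect]
  simp [hφ.coeff_eq]

lemma canonical_representation {w : Circle → ℝ} (hw : IsPositiveAnalyticWeight w) {r s a b : ℝ}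
    (hp : IsSzegoPair w s a b (szegoExt w) (invSzegoInt w)) (hsr : s < r) (hra : r < a)
    (hbr : b < 1 / r) {A A' : Set ℂ} (hA : IsCompact A) (hA' : IsCompact A')
    (hAs : A ⊆ annulus s 1) (hAs' : A' ⊆ annulus 1 (1 / s)) {m : ℕ}
    (hI : IsHalving (fun f => cauchyTransform r fun t =>
      f t * intKernel (tau w) (szegoExt w) (invSzegoInt w) (m + 1) t)
      (annulus s 1) A (annulus 1 (1 / s)) {z | ‖z‖ ≠ r})
    (hE : IsHalving (fun f => cauchyTransform (1 / r) fun t =>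
      f t * extKernel (tau w) (szegoExt w) (invSzegoInt w) (m + 1) t)
      (annulus 1 (1 / s)) A' (annulus s 1) {z | ‖z‖ ≠ 1 / r})
    {φ : ℕ → ℂ[X]} (hφ : IsOrthonormalSequence w φ) :
    (ConvergesAbsUniformlyOn (fun k => iterF w r (m + 1) (2 * k)) {z | ‖z‖ ≠ 1 / r} ∧
      ConvergesAbsUniformlyOn (fun k => iterF w r (m + 1) (2 * k + 1)) {z | ‖z‖ ≠ r} ∧
      ConvergesAbsUniformlyOn (fun k => iterG w r (m + 1) (2 * k + 1)) {z | ‖z‖ ≠ 1 / r} ∧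
      ConvergesAbsUniformlyOn (fun k => iterG w r (m + 1) (2 * k)) {z | ‖z‖ ≠ r}) ∧
    (∀ z : ℂ, ‖z‖ ≠ r → ‖z‖ ≠ 1 → ‖z‖ ≠ 1 / r →
      !![S11 w r (m + 1) z, S12 w r (m + 1) z; S21 w r (m + 1) z, S22 w r (m + 1) z] =
        matY w φ (m + 1) z * matH (m + 1) z * matK w r (m + 1) z * (matN w z)⁻¹) ∧
    (∀ z : ℂ,
      (1 / r < ‖z‖ → (monicOPUC φ (m + 1)).eval z =
        (tau w : ℂ)⁻¹ * z ^ (m + 1) * szegoExt w z * S11 w r (m + 1) z) ∧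
      (r < ‖z‖ → ‖z‖ < 1 / r → (monicOPUC φ (m + 1)).eval z =
        (tau w : ℂ)⁻¹ * z ^ (m + 1) * szegoExt w z * S11 w r (m + 1) z -
          tau w * S12 w r (m + 1) z / szegoInt w z) ∧
      (‖z‖ < r → (monicOPUC φ (m + 1)).eval z =
        -(tau w * S12 w r (m + 1) z / szegoInt w z))) ∧
    S22 w r (m + 1) 0 = 2 * Real.pi * (kappa φ m : ℂ) ^ 2 / (tau w : ℂ) ^ 2 := by
  have hr0 : 0 < r := hp.s_pos.trans hsr
  have hr1 : r < 1 := hra.trans hp.lt_one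
  have hr1' : 1 < 1 / r := by rwa [lt_one_div zero_lt_one hr0, one_div_one]
  have hrs : 1 / r < 1 / s := one_div_lt_one_div_of_lt hp.s_pos hsr
  have hτ := tau_ne_zero w
  have hpi : (Real.pi : ℂ) ≠ 0 := by exact_mod_cast Real.pi_ne_zero
  have hAB : A ⊆ {z : ℂ | ‖z‖ ≠ 1 / r} := fun z hz => ((hAs hz).2.trans hr1').ne
  have hAB' : A' ⊆ {z : ℂ | ‖z‖ ≠ r} := fun z hz => (hr1.trans (hAs' hz).1).ne'
  have hU : annulus s 1 ⊆ {z : ℂ | ‖z‖ < 1 / r} := fun z hz => hz.2.trans hr1'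
  have hU' : annulus 1 (1 / s) ⊆ {z : ℂ | r < ‖z‖} := fun z hz => hr1.trans hz.1
  set Q : ℂ[X] := C (-2 * Real.pi * (kappa φ m : ℂ)) * reversed φ m with hQ
  have hα₁ := tendsto_eval_div_pow (hφ.monicOPUC_natDegree_le (m + 1))
  rw [hφ.coeff_monicOPUC] at hα₁
  have hQdeg : Q.natDegree ≤ m := (natDegree_C_mul_le _ _).trans (hφ.natDegree_reversed_le m)
  have hα₂ := tendsto_eval_div_pow (hQdeg.trans m.le_succ)
  rw [coeff_eq_zero_of_natDegree_lt (Nat.lt_succ_of_le hQdeg)] at hα₂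
  have hβ₁ := hp.tendsto_pow_mul_cauchyTransform m (monicOPUC φ (m + 1))
    fun j _ hj => hφ.scalarProduct_monic_X_pow hw hj
  have h10 := hφ.scalarProduct_monic_X_pow hw m.succ_pos
  rw [pow_zero] at h10
  rw [h10, mul_zero] at hβ₁
  have hβ₂ := hp.tendsto_pow_mul_cauchyTransform m Q fun j h1 hj => by
    rw [hQ, scalarProduct_C_mul_left, hφ.scalarProduct_reversed_X_pow hw (by omega),
      if_neg (by omega), mul_zero]
  have h20 := hφ.scalarProduct_reversed_X_pow hw m.zero_le
  rw [pow_zero, if_pos rfl] at h20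
  -- The factor -2πκ normalizes the second row: its limits at infinity are (0, 1).
  rw [hQ, scalarProduct_C_mul_left, h20, ← hQ, show -(2 * Real.pi : ℂ)⁻¹ *
    (-2 * Real.pi * (kappa φ m : ℂ) * (kappa φ m : ℂ)⁻¹) = 1 by
      have := hφ.kappa_ne_zero m
      field_simp] at hβ₂
  obtain ⟨F₁, F₂, hF₁, hF₂, hF₁E, hF₂I, hFa, hFb, hFc, hFd, hFe, hFf, hFg⟩ :=
    hp.exists_row hsr hra hbr (m + 1) (monicOPUC φ (m + 1)).differentiable hα₁ hβ₁
  obtain ⟨G₁, G₂, hG₁, hG₂, hG₁E, hG₂I, hGa, hGb, hGc, hGd, hGe, hGf, -⟩ :=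
    hp.exists_row hsr hra hbr (m + 1) Q.differentiable hα₂ hβ₂
  obtain ⟨M₁, hM₁⟩ := hA.exists_bound_of_continuousOn (hF₁.continuousOn.mono (hAs.trans hU))
  obtain ⟨M₂, hM₂⟩ := hA'.exists_bound_of_continuousOn (hG₂.continuousOn.mono (hAs'.trans hU'))
  have hiF := fun k => iterF_succ_eq hr0 hsr hr1 hrs hI hE k
  have hiG := fun k => iterG_succ_eq hr0 hsr hr1 hrs hI hE k
  obtain ⟨cF, cF', sF, sF'⟩ := neumann_hasSum hI hE hAB hAB' (u := iterF w r (m + 1)) (M := 1)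
    (differentiableOn_const _) (fun z _ => by simp [iterF]) (fun k => (hiF k).1)
    (fun k => (hiF k).2) (hF₁.mono hU) (hF₂.mono hU') hM₁ (fun z hz => hF₁E z hz)
    (fun z hz => by rw [hF₂I z hz, zero_add])
  -- For the second row the nonzero constant is in the second entry, so the operators and the two
  -- entries exchange roles.
  obtain ⟨cG, cG', sG, sG'⟩ := neumann_hasSum hE hI hAB' hAB (u := iterG w r (m + 1)) (M := 1)
    (differentiableOn_const _) (fun z _ => by simp [iterG]) (fun k => (hiG k).1)
    (fun k => (hiG k).2) (hG₂.mono hU') (hG₁.mono hU) hM₂ (fun z hz => hG₂I z hz)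
    (fun z hz => by rw [hG₁E z hz, zero_add])
  have e11 : ∀ z, ‖z‖ ≠ 1 / r → S11 w r (m + 1) z = F₁ z := fun z hz => (sF z hz).tsum_eq
  have e12 : ∀ z, ‖z‖ ≠ r → S12 w r (m + 1) z = F₂ z := fun z hz => (sF' z hz).tsum_eq
  have e21 : ∀ z, ‖z‖ ≠ 1 / r → S21 w r (m + 1) z = G₁ z := fun z hz => (sG' z hz).tsum_eq
  have e22 : ∀ z, ‖z‖ ≠ r → S22 w r (m + 1) z = G₂ z := fun z hz => (sG z hz).tsum_eq
  refine ⟨⟨convergesAbsUniformlyOn_of_geometric cF, convergesAbsUniformlyOn_of_geometric cF',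
    convergesAbsUniformlyOn_of_geometric cG', convergesAbsUniformlyOn_of_geometric cG⟩,
    fun z h1 h2 h3 => ?_, fun z => ⟨fun hz => ?_, fun hz hz' => ?_, fun hz => ?_⟩, ?_⟩
  · rw [hp.matY_eq, mul_matH_matK_inv_matN hp hr0 hra (m + 1) h1 h2 h3, e11 z h3, e12 z h1,
      e21 z h3, e22 z h1, Nat.add_sub_cancel]
    rcases lt_or_gt_of_ne h2 with hz | hz
    · rw [hFa z hz, hGa z hz]
      rcases lt_or_gt_of_ne h1 with hzr | hzr
      · rw [if_pos hzr, hFd z hzr, hGd z hzr]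
      · rw [if_neg hzr.not_gt, if_pos hz, hFe z hzr hz, hGe z hzr hz]
    · rw [if_neg (hr1.trans hz).not_gt, if_neg hz.not_gt, hFf z hz, hGf z hz]
      rcases lt_or_gt_of_ne h3 with hzr | hzr
      · rw [if_pos hzr, hFb z hz hzr, hGb z hz hzr]
      · rw [if_neg hzr.not_gt, hFc z hzr, hGc z hzr]
  · have h1 : z ^ (m + 1) ≠ 0 := pow_ne_zero _ (norm_pos_iff.1 (by linarith))
    have h2 := hp.ext_ne_zero z (by linarith [hp.lt_one])
    rw [e11 z hz.ne', hFc z hz]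
    field_simp
  -- The region contains |z| = 1, so P is recovered from the row equations and not from the matrix
  -- identity.
  · rw [e11 z hz'.ne, e12 z hz.ne', szegoInt, div_inv_eq_mul, hFg z hz hz']
    ring
  · have h1 := hp.int_ne_zero z (by linarith [hp.one_lt])
    rw [e12 z hz.ne, hFd z hz, szegoInt, div_inv_eq_mul]
    field_simp
  · have h0 : ‖(0 : ℂ)‖ < r := by simpa using hr0
    rw [e22 0 h0.ne, hGd 0 h0, hp.int_zero, hQ, eval_mul, eval_C, hφ.eval_reversed_zero]
    field_simp

end OPUC

theorem mainTheorem1 (w : Circle → ℝ) (hw : IsPositiveAnalyticWeight w)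
    (r : ℝ) (hρr : criticalRadius w < r) (hr : r < 1) :
    (∃! φ : ℕ → ℂ[X], IsOrthonormalSequence w φ) ∧
    ∀ φ : ℕ → ℂ[X], IsOrthonormalSequence w φ → ∃ n₀ : ℕ, ∀ n : ℕ, n₀ ≤ n →
      -- convergence of the Neumann series
      (ConvergesAbsUniformlyOn (fun k => iterF w r n (2 * k)) {z | ‖z‖ ≠ 1 / r} ∧
        ConvergesAbsUniformlyOn (fun k => iterF w r n (2 * k + 1)) {z | ‖z‖ ≠ r} ∧
        ConvergesAbsUniformlyOn (fun k => iterG w r n (2 * k + 1)) {z | ‖z‖ ≠ 1 / r} ∧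
        ConvergesAbsUniformlyOn (fun k => iterG w r n (2 * k)) {z | ‖z‖ ≠ r}) ∧
      -- their sums are the entries of the matrix `S = Y H K N⁻¹`
      (∀ z : ℂ, ‖z‖ ≠ r → ‖z‖ ≠ 1 → ‖z‖ ≠ 1 / r →
        !![S11 w r n z, S12 w r n z; S21 w r n z, S22 w r n z] =
          matY w φ n z * matH n z * matK w r n z * (matN w z)⁻¹) ∧
      -- (i)
      (∀ z : ℂ,
        (1 / r < ‖z‖ →
          (monicOPUC φ n).eval z = (tau w : ℂ)⁻¹ * z ^ n * szegoExt w z * S11 w r n z) ∧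
        (r < ‖z‖ → ‖z‖ < 1 / r →
          (monicOPUC φ n).eval z = (tau w : ℂ)⁻¹ * z ^ n * szegoExt w z * S11 w r n z -
            tau w * S12 w r n z / szegoInt w z) ∧
        (‖z‖ < r →
          (monicOPUC φ n).eval z = -(tau w * S12 w r n z / szegoInt w z))) ∧
      -- (ii)
      (starRingEnd ℂ) (verblunsky φ n) = (tau w : ℂ) ^ 2 * S12 w r (n + 1) 0 ∧
      -- (iii)
      (kappa φ n : ℂ) ^ 2 = (tau w : ℂ) ^ 2 / (2 * Real.pi) * S22 w r (n + 1) 0 := by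
  refine ⟨?_, fun φ hφ => ?_⟩
  · obtain ⟨φ, hφ⟩ := exists_isOrthonormalSequence hw
    exact ⟨φ, hφ, fun ψ hψ => hψ.unique hw hφ⟩
  · obtain ⟨s, a, b, hsr, hra, hbr, hp⟩ := exists_isSzegoPair hw hρr hr
    obtain ⟨A, A', hA, hA', hAs, hAs', n₀, hn₀⟩ := hp.exists_isHalving hsr hra hbr
    have key := fun m (hm : n₀ ≤ m + 1) => canonical_representation hw hp hsr hra hbr hA hA' hAs
      hAs' (hn₀ (m + 1) hm).1 (hn₀ (m + 1) hm).2 hφ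
    have hτ := tau_ne_zero w
    have hpi : (Real.pi : ℂ) ≠ 0 := by exact_mod_cast Real.pi_ne_zero
    -- The extra 1 ensures n ≥ 1, so that n - 1 is a genuine predecessor.
    refine ⟨n₀ + 1, fun n hn => ?_⟩
    obtain ⟨m, rfl⟩ : ∃ m, n = m + 1 := ⟨n - 1, by omega⟩
    obtain ⟨h1, h2, h3, -⟩ := key m (by omega)
    -- (ii) and (iii) are statements at index n + 1: its first row contains Φ_{n+1} and its second
    -- row φ_n^*, with φ_n^*(0) = κ_n.
    obtain ⟨-, -, h3', h4⟩ := key (m + 1) (by omega)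
    refine ⟨h1, h2, h3, ?_, ?_⟩
    · have h0 : ‖(0 : ℂ)‖ < r := by simpa using hp.s_pos.trans hsr
      rw [verblunsky, map_neg, Complex.conj_conj, (h3' 0).2.2 h0, szegoInt, hp.int_zero,
        div_inv_eq_mul]
      ring
    · rw [h4]
      field_simp
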